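/- Let $\pi$ be a probability measure on a Polish space $\mathcal X$ and let $P$ be a Markov transition kernel on $\mathcal X$ that is $\pi$-irreducible and satisfies $\pi P=\pi$. Assume that there are a Borel set $J\subseteq\mathcal X$ with $\pi(J)>0$, a number $\beta>0$ and a probability measure $\nu$ such that $P(x,\cdot)\ge\beta\,\mathbf 1(x\in J)\,\nu(\cdot)$ for all $x\in\mathcal X$. Put $Q(x,\cdot)=\dfrac{P(x,\cdot)-\beta\mathbf 1(x\in J)\nu(\cdot)}{1-\beta\mathbf 1(x\in J)}$ (arbitrary where the denominator vanishes). Let $(X_n,\Gamma_n)_{n\ge0}$ be the split chain, that is, the Markov chain on $\mathcal X\times\{0,1\}$ with $X_0\sim\nu$ in which, given the past and $X_n=x$, $\Gamma_n$ equals $1$ with probability $\beta\mathbf 1(x\in J)$ and $0$ otherwise, and, given the past with $X_n=x$, $X_{n+1}$ has law $\nu$ if $\Gamma_n=1$ and law $Q(x,\cdot)$ if $\Gamma_n=0$. Let $T_0=0$ and $T_k=\min\{n>T_{k-1}:\Gamma_{n-1}=1\}$ for $k\ge1$ be the regeneration times, let $\tau_1=T_1-T_0$ and, for a function $g$, let $\Xi_1(g)=\sum_{i=T_0}^{T_1-1}g(X_i)$.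 Let $f:\mathcal X\to\mathbb R$ be Borel with $\pi(|f|)<\infty$, and put $\theta=\pi(f)=\int f\,d\pi$ and $\bar f=f-\theta$. For an integer $n\ge1$ let $R(n)=\min\{r\ge0:T_r\ge n\}$ and $$\hat\theta_{T_{R(n)}}=\frac1{T_{R(n)}}\sum_{i=0}^{T_{R(n)}-1}f(X_i).$$ If $\mathbb E(\Xi_1(\bar f))^2<\infty$ and $\mathbb E\tau_1^2<\infty$, then for every $n\ge1$ $$\text{(i)}\quad \mathbb E\bigl(\hat\theta_{T_{R(n)}}-\theta\bigr)^2\le\frac{\sigma^2_{\rm as}(f)}{n^2}\,\mathbb E\,T_{R(n)},\qquad \text{(ii)}\quad \mathbb E\,T_{R(n)}\le n+n_0,$$ where $\sigma^2_{\rm as}(f)=\dfrac{\mathbb E(\Xi_1(\bar f))^2}{\mathbb E\tau_1}$ and $n_0=\dfrac{\mathbb E\tau_1^2}{\mathbb E\tau_1}-1$. -/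

import Mathlib

open MeasureTheory ProbabilityTheory
open scoped ENNReal

namespace Regen

section Path

/-! Functionals of a path `x 0, x 1, …` of the chain and of a path `γ 0, γ 1, …` of the
regeneration indicators (`true` stands for `1`, `false` for `0`). -/

/-- The regeneration epochs: `T 0 = 0` and `T (k + 1) = min {n > T k : γ (n - 1) = 1}`,
with value `∞` if there is no such `n`. -/
noncomputable def T (γ : ℕ → Bool) : ℕ → ℕ∞
  | 0 => 0
  | k + 1 => sInf ((fun n : ℕ ↦ (n : ℕ∞)) '' {n : ℕ | T γ k < (n : ℕ∞) ∧ γ (n - 1) = true})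

/-- The cycle lengths `τ k = T k - T (k - 1)`, for `k ≥ 1`. -/
noncomputable def tau (γ : ℕ → Bool) (k : ℕ) : ℕ∞ := T γ k - T γ (k - 1)

/-- The block sums `Ξ k (g) = ∑_{T (k - 1) ≤ i < T k} g (x i)`, for `k ≥ 1`
(with a dummy value if one of the two epochs is infinite). -/
noncomputable def blockSum {S : Type*} (x : ℕ → S) (γ : ℕ → Bool) (g : S → ℝ) (k : ℕ) : ℝ :=
  ∑ i ∈ Finset.Ico (T γ (k - 1)).toNat (T γ k).toNat, g (x i)

/-- The number of blocks `R n = min {r : T r ≥ n}`. The set is never empty, as `T r ≥ r`. -/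
noncomputable def R (γ : ℕ → Bool) (n : ℕ) : ℕ := sInf {r : ℕ | (n : ℕ∞) ≤ T γ r}

/-- The length `T (R n)` of the simulated trajectory. -/
noncomputable def stopTime (γ : ℕ → Bool) (n : ℕ) : ℕ∞ := T γ (R γ n)

/-- The sequential regenerative estimator: the sample average over the times `0 ≤ i < T (R n)`. -/
noncomputable def estimator {S : Type*} (x : ℕ → S) (γ : ℕ → Bool) (f : S → ℝ) (n : ℕ) : ℝ :=
  (∑ i ∈ Finset.range (stopTime γ n).toNat, f (x i)) / ((stopTime γ n).toNat : ℝ)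

end Path

section Split

variable {S : Type*} [MeasurableSpace S]

/-- The regeneration probability `x ↦ β 1(x ∈ J)`. -/
noncomputable def regenProb (J : Set S) (β : ℝ) : S → ℝ≥0∞ :=
  J.indicator fun _ ↦ ENNReal.ofReal β

/-- The one-step small set condition: `J` is measurable, `π J > 0`, `β > 0` and
`P (x, ·) ≥ β 1(x ∈ J) ν(·)` for all `x`. -/
structure IsSmallSet (π : Measure S) (P : Kernel S S) (J : Set S) (β : ℝ) (ν : Measure S) :
    Prop where
  measurableSet : MeasurableSet J
  measure_pos : 0 < π J
  pos : 0 < β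
  minorization : ∀ x, regenProb J β x • ν ≤ P x

variable {π : Measure S} {P : Kernel S S} {J : Set S} {β : ℝ} {ν : Measure S}

theorem IsSmallSet.measurable_regenProb (h : IsSmallSet π P J β ν) :
    Measurable (regenProb J β) :=
  measurable_const.indicator h.measurableSet

theorem IsSmallSet.regenProb_le_one [IsMarkovKernel P] [IsProbabilityMeasure ν]
    (h : IsSmallSet π P J β ν) (x : S) : regenProb J β x ≤ 1 := by
  simpa using h.minorization x Set.univ

/-- The law of the regeneration indicator: `1` with probability `β 1(x ∈ J)`, otherwise `0`. -/
noncomputable def coinKernel (h : IsSmallSet π P J β ν) : Kernel S Bool where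
  toFun x := regenProb J β x • Measure.dirac true + (1 - regenProb J β x) • Measure.dirac false
  measurable' := by
    refine Measure.measurable_of_measurable_coe _ fun A hA ↦ ?_
    simp only [Measure.add_apply, Measure.smul_apply, smul_eq_mul]
    exact (h.measurable_regenProb.mul_const _).add
      ((measurable_const.sub h.measurable_regenProb).mul_const _)

instance [IsMarkovKernel P] [IsProbabilityMeasure ν] (h : IsSmallSet π P J β ν) :
    IsMarkovKernel (coinKernel h) := by
  refine ⟨fun x ↦ ⟨?_⟩⟩
  simp only [coinKernel, Kernel.coe_mk, Measure.add_apply, Measure.smul_apply, measure_univ,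
    smul_eq_mul, mul_one]
  exact add_tsub_cancel_of_le (h.regenProb_le_one x)

open scoped Classical in
/-- The normalized residual kernel
`Q (x, ·) = (P (x, ·) - β 1(x ∈ J) ν(·)) / (1 - β 1(x ∈ J))`. In the case `β = 1`, `x ∈ J`, where
the quotient is `0 / 0` and the chain never uses it, it is given the value `P (x, ·)`. -/
noncomputable def residualKernel [IsMarkovKernel P] [IsProbabilityMeasure ν]
    (h : IsSmallSet π P J β ν) : Kernel S S where
  toFun x := if regenProb J β x < 1
    then (1 - regenProb J β x)⁻¹ • (P x - regenProb J β x • ν) else P x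
  measurable' := by
    have hc := h.measurable_regenProb
    have hlt : MeasurableSet {x | regenProb J β x < 1} := measurableSet_lt hc measurable_const
    refine Measure.measurable_of_measurable_coe _ fun A hA ↦ ?_
    have key : ∀ x, (if regenProb J β x < 1
        then (1 - regenProb J β x)⁻¹ • (P x - regenProb J β x • ν) else P x) A
        = if regenProb J β x < 1
        then (1 - regenProb J β x)⁻¹ * (P x A - regenProb J β x * ν A) else P x A := by
      intro x
      split_ifs with hx
      · have : IsFiniteMeasure (regenProb J β x • ν) :=
          ⟨(h.minorization x Set.univ).trans_lt (measure_lt_top _ _)⟩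
        rw [Measure.smul_apply, Measure.sub_apply hA (h.minorization x), Measure.smul_apply,
          smul_eq_mul, smul_eq_mul]
      · rfl
    simp only [key]
    have hP := P.measurable_coe hA
    exact Measurable.ite hlt
      ((measurable_const.sub hc).inv.mul (hP.sub (hc.mul_const _))) hP

instance [IsMarkovKernel P] [IsProbabilityMeasure ν] (h : IsSmallSet π P J β ν) :
    IsMarkovKernel (residualKernel h) := by
  refine ⟨fun x ↦ ⟨?_⟩⟩
  simp only [residualKernel, Kernel.coe_mk]
  split_ifs with hx
  · have : IsFiniteMeasure (regenProb J β x • ν) :=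
      ⟨(h.minorization x Set.univ).trans_lt (measure_lt_top _ _)⟩
    rw [Measure.smul_apply, Measure.sub_apply MeasurableSet.univ (h.minorization x),
      Measure.smul_apply, measure_univ, measure_univ, smul_eq_mul, smul_eq_mul, mul_one]
    exact ENNReal.inv_mul_cancel (tsub_pos_of_lt hx).ne' (by finiteness)
  · exact measure_univ

/-- The rule of transition from `(X n, Γ n)` to `X (n + 1)`: the law `ν` if `Γ n = 1`, and
the law `Q (X n, ·)` if `Γ n = 0`. -/
noncomputable def stepKernel [IsMarkovKernel P] [IsProbabilityMeasure ν]
    (h : IsSmallSet π P J β ν) : Kernel (S × Bool) S :=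
  Kernel.piecewise (s := {z : S × Bool | z.2 = true})
    (measurableSet_eq_fun measurable_snd measurable_const)
    (Kernel.const (S × Bool) ν) ((residualKernel h).comap Prod.fst measurable_fst)

instance [IsMarkovKernel P] [IsProbabilityMeasure ν] (h : IsSmallSet π P J β ν) :
    IsMarkovKernel (stepKernel h) := by
  refine ⟨fun z ↦ ⟨?_⟩⟩
  rw [stepKernel, Kernel.piecewise_apply]
  split_ifs <;> exact measure_univ

/-- The transition kernel of the split chain on `S × {0, 1}`: first `X (n + 1)` is drawn given
`(X n, Γ n)`, then `Γ (n + 1)` is drawn given `X (n + 1)` alone. -/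
noncomputable def splitKernel [IsMarkovKernel P] [IsProbabilityMeasure ν]
    (h : IsSmallSet π P J β ν) : Kernel (S × Bool) (S × Bool) :=
  stepKernel h ⊗ₖ Kernel.prodMkLeft (S × Bool) (coinKernel h)

instance [IsMarkovKernel P] [IsProbabilityMeasure ν] (h : IsSmallSet π P J β ν) :
    IsMarkovKernel (splitKernel h) := by
  unfold splitKernel; infer_instance

/-- `Z` is a (time-homogeneous) Markov chain with initial law `μ₀` and transition kernel `κ` on
the probability space `(Ω, μ)`. -/
structure IsMarkovChain {Ω E : Type*} [MeasurableSpace Ω] [MeasurableSpace E]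
    (Z : ℕ → Ω → E) (μ₀ : Measure E) (κ : Kernel E E) (μ : Measure Ω) : Prop where
  measurable : ∀ n, Measurable (Z n)
  initial : HasLaw (Z 0) μ₀ μ
  transition : ∀ n, HasCondDistrib (Z (n + 1)) (fun ω (i : Finset.Iic n) ↦ Z i ω)
    (κ.comap (fun z : Finset.Iic n → E ↦ z ⟨n, Finset.mem_Iic.2 le_rfl⟩)
      (measurable_pi_apply _)) μ

/-- `(X, Γ)` is the split chain on `(Ω, μ)`, started from `X 0 ∼ ν`. -/
def IsSplitChain [IsMarkovKernel P] [IsProbabilityMeasure ν] (h : IsSmallSet π P J β ν)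
    {Ω : Type*} [MeasurableSpace Ω] (X : ℕ → Ω → S) (Γ : ℕ → Ω → Bool) (μ : Measure Ω) : Prop :=
  IsMarkovChain (fun n ω ↦ (X n ω, Γ n ω)) (ν ⊗ₘ coinKernel h) (splitKernel h) μ

end Split

section Moments

/-! Moments of nonnegative random variables, with values in `[0, ∞]`. -/

variable {S Ω : Type*} [MeasurableSpace Ω]

/-- `E τ₁`. -/
noncomputable def meanTau (Γ : ℕ → Ω → Bool) (μ : Measure Ω) : ℝ≥0∞ :=
  ∫⁻ ω, (tau (fun i ↦ Γ i ω) 1 : ℝ≥0∞) ∂μ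

/-- `E τ₁²`. -/
noncomputable def meanSqTau (Γ : ℕ → Ω → Bool) (μ : Measure Ω) : ℝ≥0∞ :=
  ∫⁻ ω, (tau (fun i ↦ Γ i ω) 1 : ℝ≥0∞) ^ 2 ∂μ

/-- `E (Ξ₁(g))²`. -/
noncomputable def meanSqBlock (X : ℕ → Ω → S) (Γ : ℕ → Ω → Bool) (g : S → ℝ) (μ : Measure Ω) :
    ℝ≥0∞ :=
  ∫⁻ ω, ENNReal.ofReal ((blockSum (fun i ↦ X i ω) (fun i ↦ Γ i ω) g 1) ^ 2) ∂μ

/-- `E T_{R(n)}`. -/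
noncomputable def meanStopTime (Γ : ℕ → Ω → Bool) (n : ℕ) (μ : Measure Ω) : ℝ≥0∞ :=
  ∫⁻ ω, (stopTime (fun i ↦ Γ i ω) n : ℝ≥0∞) ∂μ

/-- The mean square error of the estimator as an estimator of `θ`. -/
noncomputable def mse (X : ℕ → Ω → S) (Γ : ℕ → Ω → Bool) (f : S → ℝ) (θ : ℝ) (n : ℕ)
    (μ : Measure Ω) : ℝ≥0∞ :=
  ∫⁻ ω, ENNReal.ofReal ((estimator (fun i ↦ X i ω) (fun i ↦ Γ i ω) f n - θ) ^ 2) ∂μ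

/-- The asymptotic variance `E (Ξ₁(f - θ))² / E τ₁`. -/
noncomputable def asVar (X : ℕ → Ω → S) (Γ : ℕ → Ω → Bool) (f : S → ℝ) (θ : ℝ) (μ : Measure Ω) :
    ℝ≥0∞ :=
  meanSqBlock X Γ (fun x ↦ f x - θ) μ / meanTau Γ μ

/-- The constant `n₀ = E τ₁² / E τ₁ - 1`. Subtraction in `[0, ∞]` does not truncate here:
`τ₁ ≥ 1`, so `E τ₁² ≥ E τ₁`. -/
noncomputable def nZero (Γ : ℕ → Ω → Bool) (μ : Measure Ω) : ℝ≥0∞ :=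
  meanSqTau Γ μ / meanTau Γ μ - 1

end Moments

end Regen

/-! Only the law of the path `(X, Γ)` matters, and it is regenerative: at every epoch the path
starts afresh, independently of its past. `T_{R(n)}` is the first epoch from time `n` on, so it is
the sum over the fixed times `m < n` of `1(m is an epoch) · τ₁ ∘ shift m`; almost surely, the sum of
`f - θ` along the trajectory has the same form with `Ξ₁` in place of `τ₁`. Let `V n` be the expected
number of epochs before `n`. Independence gives `E T_{R(n)} = V n · E τ₁` (`lintegral_stopTime`).
Since blocks have mean zero, cross terms vanish and the trajectory sum has second moment `V n · E
Ξ₁²` (`integral_trajSum_sq`). The ratio of the two is the asymptotic variance, and (i) follows on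
bounding the random denominator `T_{R(n)}` below by `n`.

Blocks have mean zero by Kac's formula (`eq_smul_cycleMeasure`). With `c` the `π`-integral of `β
1_J`, invariance gives that `c` times the occupation measure of a cycle is at most `π`. The
difference is invariant and does not charge `J`, hence vanishes by irreducibility.

(ii) is Lorden's inequality (`tsum_sq_mul_sum_range_le`). The function `V` is subadditive, and the
tails `p j = P(τ₁ > j)`, once normalized, are the law of a delay that makes the expected number of
epochs before `N` equal to `N / E τ₁`. Averaging `V n ≤ V (n + i - j) + V (j - i)` over two
independent such delays `i`, `j`, and using `E τ₁² = ∑ (2 j + 1) p j`, gives the bound. -/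

namespace Regen

/-! ### Laws of Markov chains on path space. -/

section PathLaw

variable {E : Type*} [MeasurableSpace E]

/-- The initial segment of length `n` of a path. -/
def initSeg (n : ℕ) (z : ℕ → E) : Fin n → E := fun i ↦ z i

/-- The path seen from time `m` on. -/
def shift {E : Type*} (m : ℕ) (z : ℕ → E) : ℕ → E := fun i ↦ z (m + i)

/-- The events that depend on the coordinates before time `n` only. -/
@[reducible]
def past (E : Type*) [MeasurableSpace E] (n : ℕ) : MeasurableSpace (ℕ → E) :=
  MeasurableSpace.comap (initSeg n) inferInstance

@[fun_prop]
theorem measurable_initSeg (n : ℕ) : Measurable (initSeg (E := E) n) :=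
  measurable_pi_lambda _ fun _ ↦ measurable_pi_apply _

@[fun_prop]
theorem measurable_shift (m : ℕ) : Measurable (shift (E := E) m) :=
  measurable_pi_lambda _ fun _ ↦ measurable_pi_apply _

theorem past_le (n : ℕ) : past E n ≤ MeasurableSpace.pi := (measurable_initSeg n).comap_le

theorem measurable_eval_past {i n : ℕ} (h : i < n) :
    Measurable[past E n] fun z : ℕ → E ↦ z i := by
  have : Measurable[past E n] (initSeg (E := E) n) := comap_measurable _
  exact (measurable_pi_apply (⟨i, h⟩ : Fin n)).comp this

theorem measurable_past_of_eval {α : Type*} {mα : MeasurableSpace α} {n : ℕ} {F : α → ℕ → E}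
    (h : ∀ i < n, Measurable fun a ↦ F a i) : Measurable[mα, past E n] F := by
  rw [past, measurable_comap_iff]
  exact measurable_pi_lambda _ fun i ↦ h i i.2

theorem past_mono {m n : ℕ} (h : m ≤ n) : past E m ≤ past E n := by
  have : Measurable[past E n, past E m] (id : (ℕ → E) → ℕ → E) :=
    measurable_past_of_eval fun i hi ↦ measurable_eval_past (hi.trans_le h)
  simpa using this.comap_le

theorem measurable_shift_past (m n : ℕ) : Measurable[past E (m + n), past E n] (shift m) :=
  measurable_past_of_eval fun i hi ↦ measurable_eval_past (by omega)

/-- `ρ` is the law, up to normalization, of a Markov chain with transition kernel `κ`. -/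
def IsPathLaw (κ : Kernel E E) (ρ : Measure (ℕ → E)) : Prop :=
  ∀ n C, MeasurableSet[past E (n + 1)] C → ∀ B, MeasurableSet B →
    ρ (C ∩ {z | z (n + 1) ∈ B}) = ∫⁻ z in C, κ (z n) B ∂ρ

variable {κ : Kernel E E} {ρ ρ' : Measure (ℕ → E)}

theorem IsPathLaw.map_pair [IsMarkovKernel κ] [IsFiniteMeasure ρ] (h : IsPathLaw κ ρ) (n : ℕ) :
    ρ.map (fun z ↦ (initSeg (n + 1) z, z (n + 1))) =
      ρ.map (initSeg (n + 1)) ⊗ₘ κ.comap (fun w ↦ w (Fin.last n)) (measurable_pi_apply _) := by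
  have hm : Measurable fun z : ℕ → E ↦ (initSeg (n + 1) z, z (n + 1)) :=
    (measurable_initSeg _).prodMk (measurable_pi_apply _)
  refine Measure.ext_prod fun {A B} hA hB ↦ ?_
  rw [Measure.map_apply hm (hA.prod hB), Measure.compProd_apply_prod hA hB,
    setLIntegral_map hA (Kernel.measurable_coe _ hB) (measurable_initSeg _)]
  exact h n _ ⟨A, hA, rfl⟩ B hB

theorem IsPathLaw.map_initSeg_eq [IsMarkovKernel κ] [IsFiniteMeasure ρ] [IsFiniteMeasure ρ']
    (h : IsPathLaw κ ρ) (h' : IsPathLaw κ ρ')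
    (h0 : ρ.map (fun z ↦ z 0) = ρ'.map (fun z ↦ z 0)) (n : ℕ) :
    ρ.map (initSeg (n + 1)) = ρ'.map (initSeg (n + 1)) := by
  induction n with
  | zero =>
    have hc : Measurable fun (e : E) (_ : Fin 1) ↦ e := by fun_prop
    have he : initSeg (0 + 1) = (fun (e : E) (_ : Fin 1) ↦ e) ∘ fun z : ℕ → E ↦ z 0 := by
      funext z i
      simp [initSeg]
    rw [he, ← Measure.map_map hc (measurable_pi_apply _), h0,
      Measure.map_map hc (measurable_pi_apply _)]
  | succ n ih =>
    have hm : Measurable fun z : ℕ → E ↦ (initSeg (n + 1) z, z (n + 1)) :=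
      (measurable_initSeg _).prodMk (measurable_pi_apply _)
    have hc : Measurable fun p : (Fin (n + 1) → E) × E ↦
        fun i : Fin (n + 1 + 1) ↦ if hi : (i : ℕ) < n + 1 then p.1 ⟨i, hi⟩ else p.2 := by
      refine measurable_pi_lambda _ fun i ↦ ?_
      split_ifs <;> fun_prop
    have he : initSeg (n + 1 + 1) = (fun p : (Fin (n + 1) → E) × E ↦
        fun i : Fin (n + 1 + 1) ↦ if hi : (i : ℕ) < n + 1 then p.1 ⟨i, hi⟩ else p.2) ∘
        fun z : ℕ → E ↦ (initSeg (n + 1) z, z (n + 1)) := by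
      funext z i
      simp only [initSeg, Function.comp_apply]
      split_ifs with hi
      · rfl
      · congr 1; omega
    rw [he, ← Measure.map_map hc hm, ← Measure.map_map hc hm, h.map_pair, h'.map_pair, ih]

/-- The law of a Markov chain is determined by the initial law and the transition kernel. -/
theorem IsPathLaw.unique [IsMarkovKernel κ] [IsFiniteMeasure ρ] [IsFiniteMeasure ρ']
    (h : IsPathLaw κ ρ) (h' : IsPathLaw κ ρ')
    (h0 : ρ.map (fun z ↦ z 0) = ρ'.map (fun z ↦ z 0)) : ρ = ρ' := by
  refine IsProjectiveLimit.unique (P := fun I : Finset ℕ ↦ ρ.map I.restrict)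
    (fun I ↦ rfl) (fun I ↦ ?_)
  have hI : ∀ i : I, (i : ℕ) < I.sup id + 1 :=
    fun i ↦ Nat.lt_succ_of_le (Finset.le_sup (f := id) i.2)
  have hc : Measurable fun (w : Fin (I.sup id + 1) → E) (i : I) ↦ w ⟨i, hI i⟩ := by fun_prop
  have he : I.restrict = (fun (w : Fin (I.sup id + 1) → E) (i : I) ↦ w ⟨i, hI i⟩) ∘
      initSeg (I.sup id + 1) := rfl
  simp only [he]
  rw [← Measure.map_map hc (measurable_initSeg _), ← Measure.map_map hc (measurable_initSeg _),
    h.map_initSeg_eq h' h0]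

/-- Restricting to an event `C` of the past leaves a law of mass `ρ C`; scaling allows such a law to
be compared with a multiple of the original one. -/
theorem IsPathLaw.smul (h : IsPathLaw κ ρ) (c : ℝ≥0∞) : IsPathLaw κ (c • ρ) := by
  intro n C hC B hB
  rw [Measure.smul_apply, Measure.restrict_smul, lintegral_smul_measure, h n C hC B hB]

/-- The Markov property at a fixed time `m`, without its identification of the law. -/
theorem IsPathLaw.map_shift_restrict (h : IsPathLaw κ ρ) {m : ℕ} {C : Set (ℕ → E)}
    (hC : MeasurableSet[past E m] C) : IsPathLaw κ ((ρ.restrict C).map (shift m)) := by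
  intro n A hA B hB
  have hA' := past_le _ _ hA
  have hC' := past_le _ _ hC
  have hB' : MeasurableSet {z : ℕ → E | z (n + 1) ∈ B} := measurable_pi_apply _ hB
  have hκ : Measurable fun z : ℕ → E ↦ κ (z n) B :=
    (κ.measurable_coe hB).comp (measurable_pi_apply n)
  rw [Measure.map_apply (measurable_shift m) (hA'.inter hB'),
    setLIntegral_map hA' hκ (measurable_shift m),
    Measure.restrict_apply (measurable_shift m (hA'.inter hB')),
    Measure.restrict_restrict (measurable_shift m hA')]
  have key := h (m + n) (shift m ⁻¹' A ∩ C)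
    ((measurable_shift_past m (n + 1) hA).inter (past_mono (by omega) _ hC)) B hB
  rw [show shift m ⁻¹' (A ∩ {z | z (n + 1) ∈ B}) ∩ C =
    shift m ⁻¹' A ∩ C ∩ {z | z (m + n + 1) ∈ B} by
      ext z; simp [shift, add_assoc, and_comm, and_left_comm], key]
  rfl

theorem IsMarkovChain.isPathLaw {Ω : Type*} [MeasurableSpace Ω] {μ : Measure Ω}
    [IsProbabilityMeasure μ] [IsMarkovKernel κ] {Z : ℕ → Ω → E} {μ₀ : Measure E}
    (h : IsMarkovChain Z μ₀ κ μ) : IsPathLaw κ (μ.map fun ω n ↦ Z n ω) := by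
  have hZ : Measurable fun ω n ↦ Z n ω := measurable_pi_lambda _ h.measurable
  rintro n C ⟨A, hA, rfl⟩ B hB
  have hm := (measurable_initSeg (E := E) (n + 1)) hA
  have hB' : MeasurableSet {z : ℕ → E | z (n + 1) ∈ B} := measurable_pi_apply _ hB
  have hκ : Measurable fun z : ℕ → E ↦ κ (z n) B :=
    (κ.measurable_coe hB).comp (measurable_pi_apply n)
  rw [Measure.map_apply hZ (hm.inter hB'), setLIntegral_map hm hκ hZ]
  have ht := (h.transition n).map_eq
  let e : (Finset.Iic n → E) → Fin (n + 1) → E :=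
    fun w i ↦ w ⟨i, Finset.mem_Iic.2 (Nat.lt_succ_iff.1 i.2)⟩
  have he : Measurable e := by fun_prop
  have hhist : Measurable fun ω (i : Finset.Iic n) ↦ Z i ω :=
    measurable_pi_lambda _ fun i ↦ h.measurable i
  have := congrArg (fun ρ ↦ ρ ((e ⁻¹' A) ×ˢ B)) ht
  rw [Measure.map_apply (hhist.prodMk (h.measurable _)) ((he hA).prod hB),
    Measure.compProd_apply_prod (he hA) hB,
    setLIntegral_map (he hA) (Kernel.measurable_coe _ hB) hhist] at this
  exact this

end PathLaw

/-! ### Pathwise identities for epochs and cycles. -/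

section Pathwise

variable {S : Type*} {γ : ℕ → Bool}

/-- The time `m` is a regeneration epoch. -/
def IsEpoch (m : ℕ) (γ : ℕ → Bool) : Prop := m = 0 ∨ γ (m - 1) = true

instance (m : ℕ) (γ : ℕ → Bool) : Decidable (IsEpoch m γ) :=
  inferInstanceAs (Decidable (_ ∨ _))

/-- Natural lower bounds determine an element of `ℕ∞`, so this form treats finite and infinite
epochs alike. -/
theorem le_T_succ_iff {k r : ℕ} :
    (k : ℕ∞) ≤ T γ (r + 1) ↔ ∀ m : ℕ, T γ r < m → γ (m - 1) = true → k ≤ m := by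
  simp only [T, le_sInf_iff, Set.mem_image, Set.mem_ofPred_eq, forall_exists_index, and_imp]
  exact ⟨fun h m h1 h2 ↦ by exact_mod_cast h m m h1 h2 rfl,
    fun h b m h1 h2 hb ↦ hb ▸ by exact_mod_cast h m h1 h2⟩

theorem natCast_le_T (r : ℕ) : (r : ℕ∞) ≤ T γ r := by
  induction r with
  | zero => simp
  | succ r ih =>
    refine le_T_succ_iff.2 fun m hm _ ↦ ?_
    exact_mod_cast ih.trans_lt hm

theorem natCast_lt_T_one_iff {j : ℕ} : (j : ℕ∞) < T γ 1 ↔ ∀ i < j, γ i = false := by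
  rw [← ENat.add_one_le_iff (ENat.natCast_ne_top j)]
  have := le_T_succ_iff (γ := γ) (k := j + 1) (r := 0)
  push_cast at this
  rw [this]
  constructor
  · intro h i hi
    by_contra hc
    have := h (i + 1) (by simp [T]) (by simpa using hc)
    omega
  · intro h m hm hγ
    by_contra hc
    have hm' : 0 < m := by simpa [T] using hm
    rw [h (m - 1) (by omega)] at hγ
    simp at hγ

theorem natCast_le_stopTime (n : ℕ) : (n : ℕ∞) ≤ stopTime γ n :=
  Nat.sInf_mem (s := {r : ℕ | (n : ℕ∞) ≤ T γ r}) ⟨n, natCast_le_T n⟩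

/-- The simulated trajectory ends at the first regeneration epoch from time `n` on. -/
theorem natCast_le_stopTime_iff {k n : ℕ} :
    (k : ℕ∞) ≤ stopTime γ n ↔ ∀ m, n ≤ m → IsEpoch m γ → k ≤ m := by
  have hn : (n : ℕ∞) ≤ stopTime γ n := natCast_le_stopTime n
  have hmin : ∀ r < R γ n, T γ r < n := fun r hr ↦ not_le.1 (Nat.notMem_of_lt_sInf hr)
  unfold stopTime at hn ⊢
  rcases hR : R γ n with _ | r
  · have h0 : n = 0 := by simpa [hR, T] using hn
    subst h0
    constructor
    · intro h m _ _
      have : k = 0 := by simpa [T] using h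
      omega
    · intro h
      have := h 0 le_rfl (Or.inl rfl)
      simpa [T] using this
  · rw [hR] at hn
    have hr := hmin r (by omega)
    rw [le_T_succ_iff]
    constructor
    · intro h m hm he
      have hm' : T γ r < m := hr.trans_le (by exact_mod_cast hm)
      refine h m hm' (he.resolve_left ?_)
      rintro rfl
      simp at hm'
    · intro h m hm hγ
      exact h m (le_T_succ_iff.1 hn m hm hγ) (Or.inr hγ)

theorem eq_of_forall_natCast_le_iff {a b : ℕ∞} (h : ∀ k : ℕ, (k : ℕ∞) ≤ a ↔ (k : ℕ∞) ≤ b) :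
    a = b :=
  le_antisymm (ENat.forall_natCast_le_iff_le.1 fun k ↦ (h k).1)
    (ENat.forall_natCast_le_iff_le.1 fun k ↦ (h k).2)

theorem stopTime_zero : stopTime γ 0 = 0 :=
  le_antisymm (ENat.forall_natCast_le_iff_le.1 fun k hk ↦ by
    simpa using natCast_le_stopTime_iff.1 hk 0 le_rfl (Or.inl rfl)) zero_le

theorem stopTime_of_isEpoch {n : ℕ} (h : IsEpoch n γ) : stopTime γ n = n :=
  le_antisymm (ENat.forall_natCast_le_iff_le.1 fun k hk ↦ by
    simpa using natCast_le_stopTime_iff.1 hk n le_rfl h) (natCast_le_stopTime n)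

theorem stopTime_succ_of_not_isEpoch {n : ℕ} (h : ¬ IsEpoch n γ) :
    stopTime γ (n + 1) = stopTime γ n := by
  refine eq_of_forall_natCast_le_iff fun k ↦ ?_
  rw [natCast_le_stopTime_iff, natCast_le_stopTime_iff]
  refine ⟨fun H m hm he ↦ H m ?_ he, fun H m hm he ↦ H m (by omega) he⟩
  rcases hm.eq_or_lt with rfl | hm
  · exact absurd he h
  · exact hm

/-- The first epoch from `n` on is also the first from `n + 1` on, unless it is `n` itself; then the
next one is the end of the cycle that begins at `n`. -/
theorem stopTime_succ (n : ℕ) : stopTime γ (n + 1) = if IsEpoch n γ then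
    n + T (shift n γ) 1 else stopTime γ n := by
  split_ifs with h
  swap
  · exact stopTime_succ_of_not_isEpoch h
  refine eq_of_forall_natCast_le_iff fun k ↦ ?_
  rcases le_total k n with hk | hk
  · have hk' : (k : ℕ∞) ≤ n := by exact_mod_cast hk
    refine iff_of_true (hk'.trans ?_) (hk'.trans le_self_add)
    exact le_trans (by exact_mod_cast n.le_succ) (natCast_le_stopTime (n + 1))
  · obtain ⟨j, rfl⟩ := Nat.exists_eq_add_of_le hk
    rw [Nat.cast_add, ENat.add_le_add_iff_left (ENat.natCast_ne_top n), ← Nat.cast_add,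
      natCast_le_stopTime_iff]
    have := le_T_succ_iff (γ := shift n γ) (k := j) (r := 0)
    rw [zero_add] at this
    rw [this]
    constructor
    · intro H m hm hγ
      have hm' : 0 < m := by simpa [T] using hm
      have := H (n + m) (by omega) (Or.inr (by simpa [shift, Nat.add_sub_assoc hm'] using hγ))
      omega
    · intro H m hm he
      have hγ := he.resolve_left (by omega)
      obtain ⟨i, rfl⟩ := Nat.exists_eq_add_of_le hm
      have := H (i + 1) (by simp [T]) (by
        simpa [shift, show n + 1 + i - 1 = n + i by omega] using hγ)
      omega

/-- A sum over a random number of cycles becomes a sum over deterministic times, so regeneration is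
needed at fixed times only. -/
theorem stopTime_toENNReal (n : ℕ) : (stopTime γ n : ℝ≥0∞) =
    ∑ m ∈ Finset.range n, if IsEpoch m γ then (T (shift m γ) 1 : ℝ≥0∞) else 0 := by
  induction n with
  | zero => simp [stopTime_zero]
  | succ n ih =>
    rw [Finset.sum_range_succ, ← ih, stopTime_succ]
    split_ifs with h
    · rw [stopTime_of_isEpoch h, ENat.toENNReal_add]
    · simp

theorem tau_one : tau γ 1 = T γ 1 := by simp [tau, T]

theorem blockSum_one (x : ℕ → S) (g : S → ℝ) :
    blockSum x γ g 1 = ∑ i ∈ Finset.range (T γ 1).toNat, g (x i) := by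
  rw [blockSum, show T γ (1 - 1) = 0 from rfl, ENat.toNat_zero, Finset.range_eq_Ico]

/-- The sum of `g` along the simulated trajectory. -/
noncomputable def trajSum (x : ℕ → S) (γ : ℕ → Bool) (g : S → ℝ) (n : ℕ) : ℝ :=
  ∑ i ∈ Finset.range (stopTime γ n).toNat, g (x i)

theorem trajSum_of_isEpoch {n : ℕ} (h : IsEpoch n γ) (x : ℕ → S) (g : S → ℝ) :
    trajSum x γ g n = ∑ i ∈ Finset.range n, g (x i) := by
  rw [trajSum, stopTime_of_isEpoch h, ENat.toNat_natCast]

/-- Finiteness is required because `toNat` sends `⊤` to `0`, which would replace an unfinished block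
by an empty sum. -/
theorem trajSum_succ {n : ℕ} (h : stopTime γ (n + 1) ≠ ⊤) (x : ℕ → S) (g : S → ℝ) :
    trajSum x γ g (n + 1) = trajSum x γ g n +
      if IsEpoch n γ then blockSum (shift n x) (shift n γ) g 1 else 0 := by
  split_ifs with he
  · rw [trajSum_of_isEpoch he, trajSum, blockSum_one]
    rw [stopTime_succ, if_pos he] at h ⊢
    have hT : T (shift n γ) 1 ≠ ⊤ := fun hT ↦ h (by simp [hT])
    rw [ENat.toNat_add (ENat.natCast_ne_top n) hT, ENat.toNat_natCast, Finset.sum_range_add]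
    rfl
  · rw [trajSum, trajSum, stopTime_succ, if_neg he, add_zero]

/-- Exactly one epoch is the last one up to time `m`. -/
theorem sum_last_epoch (m : ℕ) : (∑ l ∈ Finset.range (m + 1),
    if IsEpoch l γ ∧ ((m - l : ℕ) : ℕ∞) < T (shift l γ) 1 then (1 : ℝ≥0∞) else 0) = 1 := by
  induction m with
  | zero => rw [Finset.sum_range_one, if_pos ⟨Or.inl rfl, natCast_lt_T_one_iff.2 (by simp)⟩]
  | succ m ih =>
    rw [Finset.sum_range_succ]
    -- If `m + 1` is an epoch, then `γ m = true` ends every earlier cycle; otherwise none of the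
    -- earlier conditions changes.
    by_cases h : IsEpoch (m + 1) γ
    · have hγ : γ m = true := by simpa [IsEpoch] using h
      rw [Finset.sum_eq_zero, zero_add, if_pos ⟨h, natCast_lt_T_one_iff.2 (by simp)⟩]
      intro l hl
      have hl' := Finset.mem_range.1 hl
      refine if_neg fun hc ↦ ?_
      have := natCast_lt_T_one_iff.1 hc.2 (m - l) (by omega)
      simp [shift, show l + (m - l) = m by omega, hγ] at this
    · rw [if_neg (fun hc ↦ h hc.1), add_zero]
      refine Eq.trans ?_ ih
      have hγ : γ m = false := by simpa [IsEpoch] using h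
      refine Finset.sum_congr rfl fun l hl ↦ if_congr (and_congr_right fun _ ↦ ?_) rfl rfl
      have hl' := Finset.mem_range.1 hl
      rw [natCast_lt_T_one_iff, natCast_lt_T_one_iff]
      refine ⟨fun H i hi ↦ H i (by omega), fun H i hi ↦ ?_⟩
      rcases Nat.lt_or_ge i (m - l) with hi' | hi'
      · exact H i hi'
      · simpa [shift, show l + i = m by omega] using hγ

theorem toENNReal_eq_tsum (a : ℕ∞) :
    (a : ℝ≥0∞) = ∑' j : ℕ, if (j : ℕ∞) < a then (1 : ℝ≥0∞) else 0 := by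
  induction a using ENat.recTopCoe with
  | top => simp
  | coe k =>
    rw [tsum_eq_sum (s := Finset.range k) (fun j hj ↦ by simpa using hj), Finset.sum_congr rfl
      (fun j hj ↦ if_pos (by simpa using hj))]
    simp

/-- The weights are the increments `(j + 1)² - j²`. -/
theorem toENNReal_sq_eq_tsum (a : ℕ∞) :
    (a : ℝ≥0∞) ^ 2 = ∑' j : ℕ, (2 * j + 1) * if (j : ℕ∞) < a then (1 : ℝ≥0∞) else 0 := by
  induction a using ENat.recTopCoe with
  | top =>
    symm
    simp only [ENat.natCast_lt_top, if_true, mul_one, ENat.toENNReal_top]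
    rw [ENNReal.top_pow (by norm_num), eq_top_iff,
      ← ENNReal.tsum_const_eq_top_of_ne_zero (α := ℕ) one_ne_zero]
    exact ENNReal.tsum_le_tsum fun j ↦ le_add_self
  | coe k =>
    rw [tsum_eq_sum (s := Finset.range k) (fun j hj ↦ by simpa using hj), Finset.sum_congr rfl
      (fun j hj ↦ by rw [if_pos (by simpa using hj), mul_one])]
    rw [ENat.toENNReal_coe]
    induction k with
    | zero => simp
    | succ k ih => rw [Finset.sum_range_succ, ← ih]; push_cast; ring

end Pathwise

/-! ### Renewal equation and Lorden's inequality for sequences. -/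

section RenewalSequence

variable {u p : ℕ → ℝ≥0∞}

/-- This is the renewal equation summed over `m < N`; truncated subtraction makes the terms with `j
≥ N` vanish. -/
theorem tsum_mul_sum_range_sub (hlast : ∀ m, ∑ l ∈ Finset.range (m + 1), u l * p (m - l) = 1)
    (N : ℕ) : ∑' j, p j * ∑ l ∈ Finset.range (N - j), u l = N := by
  induction N with
  | zero => simp
  | succ N ih =>
    have hj : ∀ j, p j * ∑ l ∈ Finset.range (N + 1 - j), u l =
        p j * ∑ l ∈ Finset.range (N - j), u l + if j < N + 1 then p j * u (N - j) else 0 := by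
      intro j
      split_ifs with h
      · rw [Nat.sub_add_comm (by omega), Finset.sum_range_succ, mul_add]
      · rw [Nat.sub_eq_zero_of_le (by omega), Nat.sub_eq_zero_of_le (by omega), add_zero]
    simp only [hj]
    rw [ENNReal.tsum_add, ih, tsum_eq_sum (s := Finset.range (N + 1))
      (fun j hj ↦ if_neg (by simpa using hj)), Finset.sum_congr rfl
      (fun j hj ↦ if_pos (Finset.mem_range.1 hj)), Nat.cast_succ]
    congr 1
    rw [← hlast N, ← Finset.sum_range_reflect]
    refine Finset.sum_congr rfl fun j hj ↦ ?_
    have := Finset.mem_range.1 hj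
    rw [mul_comm, show N + 1 - 1 - j = N - j by omega, show N - (N - j) = j by omega]

/-- Lorden's inequality for the renewal sequence `u` with cycle length tails `p`. -/
theorem tsum_sq_mul_sum_range_le
    (hsub : ∀ n m, ∑ l ∈ Finset.range (n + m), u l ≤
      ∑ l ∈ Finset.range n, u l + ∑ l ∈ Finset.range m, u l)
    (hlast : ∀ m, ∑ l ∈ Finset.range (m + 1), u l * p (m - l) = 1) (n : ℕ) :
    (∑' j, p j) * ((∑' j, p j) * ∑ l ∈ Finset.range n, u l) ≤
      (∑' j, p j) * n + 2 * ∑' j, p j * j := by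
  set V : ℕ → ℝ≥0∞ := fun n ↦ ∑ l ∈ Finset.range n, u l
  have hV : Monotone V := fun a b hab ↦
    Finset.sum_le_sum_of_subset (Finset.range_subset_range.2 hab)
  have hren := tsum_mul_sum_range_sub hlast
  -- With truncated subtraction, `n ≤ (n + i - j) + (j - i)` holds whatever the order of `i` and
  -- `j`.
  have hle : ∀ i j, V n ≤ V (n + i - j) + V (j - i) := fun i j ↦
    (hV (by omega)).trans (hsub (n + i - j) (j - i))
  calc (∑' j, p j) * ((∑' j, p j) * V n)
      = ∑' i, ∑' j, p i * (p j * V n) := by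
        rw [← ENNReal.tsum_mul_right]
        refine tsum_congr fun i ↦ ?_
        rw [← ENNReal.tsum_mul_right, ENNReal.tsum_mul_left]
    _ ≤ ∑' i, ∑' j, (p i * (p j * V (n + i - j)) + p i * (p j * V (j - i))) := by
        refine ENNReal.tsum_le_tsum fun i ↦ ENNReal.tsum_le_tsum fun j ↦ ?_
        rw [← mul_add, ← mul_add]
        gcongr
        exact hle i j
    -- In the first double sum `hren` at `n + i` sums out `j`; in the second, `hren` at `j` sums out
    -- `i`.
    _ = ∑' i, p i * ((n + i : ℕ) : ℝ≥0∞) + ∑' j, p j * j := by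
        simp only [ENNReal.tsum_add]
        congr 1
        · refine tsum_congr fun i ↦ ?_
          rw [ENNReal.tsum_mul_left, hren]
        · rw [ENNReal.tsum_comm]
          refine tsum_congr fun j ↦ ?_
          rw [← hren j, ← ENNReal.tsum_mul_left]
          exact tsum_congr fun i ↦ mul_left_comm _ _ _
    _ = (∑' j, p j) * n + 2 * ∑' j, p j * j := by
        simp only [Nat.cast_add, mul_add, ENNReal.tsum_add, ENNReal.tsum_mul_right]
        rw [add_assoc, two_mul]

end RenewalSequence

/-! ### Measurability of epochs and block sums. -/

section Measurability

theorem measurable_of_natCast_le {α : Type*} [MeasurableSpace α] {f : α → ℕ∞}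
    (h : ∀ k : ℕ, MeasurableSet {a | (k : ℕ∞) ≤ f a}) : Measurable f := by
  refine measurable_to_countable' fun x ↦ ?_
  have : f ⁻¹' {x} = ⋂ k : ℕ, {a | (k : ℕ∞) ≤ f a ↔ (k : ℕ∞) ≤ x} := by
    ext a
    simp only [Set.mem_preimage, Set.mem_singleton_iff, Set.mem_iInter]
    exact ⟨fun h k ↦ by simp [h], fun h ↦ eq_of_forall_natCast_le_iff h⟩
  rw [this]
  exact MeasurableSet.iInter fun k ↦ (h k).iff (MeasurableSet.const _)

theorem measurableSet_isEpoch (m : ℕ) : MeasurableSet {γ : ℕ → Bool | IsEpoch m γ} :=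
  (MeasurableSet.const _).union (measurableSet_eq_fun (measurable_pi_apply _) measurable_const)

@[fun_prop]
theorem measurable_stopTime (n : ℕ) : Measurable fun γ ↦ stopTime γ n := by
  refine measurable_of_natCast_le fun k ↦ ?_
  simp only [natCast_le_stopTime_iff]
  have : {γ : ℕ → Bool | ∀ m, n ≤ m → IsEpoch m γ → k ≤ m} =
      ⋂ m : ℕ, ⋂ _ : n ≤ m, ({γ | IsEpoch m γ}ᶜ ∪ {_γ | k ≤ m}) := by
    ext γ; simp [imp_iff_not_or]
  rw [this]
  exact MeasurableSet.iInter fun m ↦ MeasurableSet.iInter fun _ ↦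
    (measurableSet_isEpoch m).compl.union (MeasurableSet.const _)

theorem T_one_eq_stopTime (γ : ℕ → Bool) : T γ 1 = stopTime γ 1 := by
  have h := stopTime_succ (γ := γ) 0
  rw [if_pos (show IsEpoch 0 γ from Or.inl rfl), show shift 0 γ = γ by funext i; simp [shift]] at h
  simpa using h.symm

@[fun_prop]
theorem measurable_T_one : Measurable fun γ ↦ T γ 1 := by
  simp only [T_one_eq_stopTime]
  fun_prop

variable {S : Type*} [MeasurableSpace S]

/-- The regeneration indicators along a path of the split chain. -/
def ind {S : Type*} (z : ℕ → S × Bool) : ℕ → Bool := fun i ↦ (z i).2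

/-- The positions along a path of the split chain. -/
def pos {S : Type*} (z : ℕ → S × Bool) : ℕ → S := fun i ↦ (z i).1

@[fun_prop]
theorem measurable_ind : Measurable (ind (S := S)) :=
  measurable_pi_lambda _ fun i ↦ (measurable_pi_apply i).snd

@[fun_prop]
theorem measurable_pos : Measurable (pos (S := S)) :=
  measurable_pi_lambda _ fun i ↦ (measurable_pi_apply i).fst

theorem measurable_sum_range {g : S → ℝ} (hg : Measurable g) {N : (ℕ → S × Bool) → ℕ}
    (hN : Measurable N) : Measurable fun z ↦ ∑ i ∈ Finset.range (N z), g (pos z i) := by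
  have h : Measurable fun q : (ℕ → S × Bool) × ℕ ↦ ∑ i ∈ Finset.range q.2, g (pos q.1 i) :=
    measurable_from_prod_countable_left fun k ↦ by
      show Measurable fun z : ℕ → S × Bool ↦ ∑ i ∈ Finset.range k, g (pos z i)
      exact Finset.measurable_sum _ fun i _ ↦ hg.comp ((measurable_pi_apply i).comp measurable_pos)
  exact h.comp (measurable_id.prodMk hN)

theorem measurable_trajSum {g : S → ℝ} (hg : Measurable g) (n : ℕ) :
    Measurable fun z ↦ trajSum (pos z) (ind z) g n :=
  measurable_sum_range hg ((measurable_of_countable ENat.toNat).comp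
    ((measurable_stopTime n).comp measurable_ind))

theorem measurable_blockSum_one {g : S → ℝ} (hg : Measurable g) :
    Measurable fun z ↦ blockSum (pos z) (ind z) g 1 := by
  simp only [blockSum_one]
  exact measurable_sum_range hg ((measurable_of_countable ENat.toNat).comp
    (measurable_T_one.comp measurable_ind))

end Measurability

/-! ### Regenerative laws, the renewal measure and the mean stopping time. -/

section Regenerative

variable {S : Type*} [MeasurableSpace S]

/-- The event that `m` is a regeneration epoch of the path. -/
def epoch (S : Type*) (m : ℕ) : Set (ℕ → S × Bool) := {z | IsEpoch m (ind z)}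

theorem measurableSet_epoch_past (m : ℕ) : MeasurableSet[past (S × Bool) m] (epoch S m) := by
  rcases m with _ | m
  · have : epoch S 0 = Set.univ := Set.eq_univ_of_forall fun _ ↦ Or.inl rfl
    rw [this]
    exact MeasurableSet.univ
  · have : epoch S (m + 1) = (fun z : ℕ → S × Bool ↦ z m) ⁻¹' (Prod.snd ⁻¹' {true}) := by
      ext z; simp [epoch, IsEpoch, ind]
    rw [this]
    exact measurable_eval_past (by omega) (measurable_snd (measurableSet_singleton _))

theorem measurableSet_epoch (m : ℕ) : MeasurableSet (epoch S m) :=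
  past_le _ _ (measurableSet_epoch_past m)

/-- The path starts afresh, independently of its past, at each regeneration epoch. -/
structure IsRegenerative (ℒ : Measure (ℕ → S × Bool)) : Prop where
  map_shift : ∀ m C, MeasurableSet[past (S × Bool) m] C → C ⊆ epoch S m →
    (ℒ.restrict C).map (shift m) = ℒ C • ℒ

variable {ℒ : Measure (ℕ → S × Bool)}

/-- The probability that time `m` is a regeneration epoch. -/
noncomputable def epochProb (ℒ : Measure (ℕ → S × Bool)) (m : ℕ) : ℝ≥0∞ := ℒ (epoch S m)

/-- The probability that the first cycle is longer than `j`. -/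
noncomputable def tailProb (ℒ : Measure (ℕ → S × Bool)) (j : ℕ) : ℝ≥0∞ :=
  ℒ {z | (j : ℕ∞) < T (ind z) 1}

theorem measurableSet_natCast_lt_T_one (j : ℕ) :
    MeasurableSet {z : ℕ → S × Bool | (j : ℕ∞) < T (ind z) 1} :=
  (measurable_T_one.comp measurable_ind) (MeasurableSet.of_discrete (s := Set.Ioi (j : ℕ∞)))

theorem measurable_toENNReal_T_one :
    Measurable fun z : ℕ → S × Bool ↦ (T (ind z) 1 : ℝ≥0∞) :=
  (measurable_of_countable _).comp (measurable_T_one.comp measurable_ind)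

namespace IsRegenerative

theorem measure_inter_shift (h : IsRegenerative ℒ) {m : ℕ} {C B : Set (ℕ → S × Bool)}
    (hC : MeasurableSet[past (S × Bool) m] C) (hCe : C ⊆ epoch S m) (hB : MeasurableSet B) :
    ℒ (C ∩ shift m ⁻¹' B) = ℒ C * ℒ B := by
  have := congrArg (fun ρ ↦ ρ B) (h.map_shift m C hC hCe)
  simp only [Measure.smul_apply, smul_eq_mul] at this
  rwa [Measure.map_apply (measurable_shift m) hB,
    Measure.restrict_apply (measurable_shift m hB), Set.inter_comm] at this

theorem setLIntegral_shift (h : IsRegenerative ℒ) (m : ℕ) {F : (ℕ → S × Bool) → ℝ≥0∞}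
    (hF : Measurable F) :
    ∫⁻ z in epoch S m, F (shift m z) ∂ℒ = epochProb ℒ m * ∫⁻ z, F z ∂ℒ := by
  rw [← lintegral_map hF (measurable_shift m),
    h.map_shift m _ (measurableSet_epoch_past m) subset_rfl, lintegral_smul_measure]
  rfl

/-- Wald's first identity: whether `m` is an epoch is decided by the past, and the cycle begun there
has the law of the first one. -/
theorem lintegral_stopTime (h : IsRegenerative ℒ) (n : ℕ) :
    ∫⁻ z, (stopTime (ind z) n : ℝ≥0∞) ∂ℒ =
      (∑ m ∈ Finset.range n, epochProb ℒ m) * ∫⁻ z, (T (ind z) 1 : ℝ≥0∞) ∂ℒ := by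
  simp only [stopTime_toENNReal]
  have he : ∀ m (z : ℕ → S × Bool),
      (if IsEpoch m (ind z) then (T (shift m (ind z)) 1 : ℝ≥0∞) else 0) =
        (epoch S m).indicator (fun z ↦ (T (ind (shift m z)) 1 : ℝ≥0∞)) z := fun m z ↦ by
    split_ifs with hz
    · exact (Set.indicator_of_mem (s := epoch S m) hz
        fun z ↦ (T (ind (shift m z)) 1 : ℝ≥0∞)).symm
    · exact (Set.indicator_of_notMem (s := epoch S m) hz
        fun z ↦ (T (ind (shift m z)) 1 : ℝ≥0∞)).symm
  simp only [he]
  have hmeas : ∀ m, Measurable ((epoch S m).indicator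
      (fun z ↦ (T (ind (shift m z)) 1 : ℝ≥0∞))) := fun m ↦
    (measurable_toENNReal_T_one.comp (measurable_shift m)).indicator (measurableSet_epoch m)
  rw [lintegral_finsetSum _ fun m _ ↦ hmeas m, Finset.sum_mul]
  refine Finset.sum_congr rfl fun m _ ↦ ?_
  rw [lintegral_indicator (measurableSet_epoch m)]
  exact h.setLIntegral_shift m measurable_toENNReal_T_one

/-- On the epoch, past and future are independent, that is, the restricted law of `(initSeg m, shift
m)` is a product. The product formula then needs no integrability. -/
theorem setIntegral_mul_shift [IsProbabilityMeasure ℒ] (h : IsRegenerative ℒ) (m : ℕ)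
    {G : (Fin m → S × Bool) → ℝ} (hG : Measurable G) {F : (ℕ → S × Bool) → ℝ}
    (hF : Measurable F) :
    ∫ z in epoch S m, G (initSeg m z) * F (shift m z) ∂ℒ =
      (∫ z in epoch S m, G (initSeg m z) ∂ℒ) * ∫ z, F z ∂ℒ := by
  have hm : Measurable fun z : ℕ → S × Bool ↦ (initSeg m z, shift m z) := by fun_prop
  have hprod : ((ℒ.restrict (epoch S m)).map (initSeg m)).prod ℒ =
      (ℒ.restrict (epoch S m)).map fun z ↦ (initSeg m z, shift m z) := by
    refine Measure.prod_eq fun A B hA hB ↦ ?_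
    rw [Measure.map_apply hm (hA.prod hB), Measure.map_apply (measurable_initSeg m) hA,
      Measure.restrict_apply (hm (hA.prod hB)),
      Measure.restrict_apply (measurable_initSeg m hA)]
    have hA' : MeasurableSet[past (S × Bool) m] (initSeg m ⁻¹' A) := ⟨A, hA, rfl⟩
    rw [← h.measure_inter_shift (hA'.inter (measurableSet_epoch_past m)) Set.inter_subset_right hB]
    congr 1
    ext z
    simp [and_comm, and_left_comm]
  rw [← integral_map (φ := initSeg m) (by fun_prop) (by fun_prop), ← integral_prod_mul, hprod,
    integral_map (by fun_prop) (by fun_prop)]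

/-- Expectation of `sum_last_epoch`, each summand factoring by regeneration at `l`. -/
theorem sum_epochProb_mul_tailProb [IsProbabilityMeasure ℒ] (h : IsRegenerative ℒ) (m : ℕ) :
    ∑ l ∈ Finset.range (m + 1), epochProb ℒ l * tailProb ℒ (m - l) = 1 := by
  have h1 : ∫⁻ z, (∑ l ∈ Finset.range (m + 1),
      if IsEpoch l (ind z) ∧ ((m - l : ℕ) : ℕ∞) < T (shift l (ind z)) 1 then (1 : ℝ≥0∞) else 0) ∂ℒ
        = 1 := by
    simp only [sum_last_epoch, lintegral_const, measure_univ, mul_one]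
  rw [← h1]
  have he : ∀ l (z : ℕ → S × Bool),
      (if IsEpoch l (ind z) ∧ ((m - l : ℕ) : ℕ∞) < T (shift l (ind z)) 1 then (1 : ℝ≥0∞) else 0) =
        (epoch S l ∩ shift l ⁻¹' {z | ((m - l : ℕ) : ℕ∞) < T (ind z) 1}).indicator 1 z :=
    fun l z ↦ by
      split_ifs with hz
      · exact (Set.indicator_of_mem (s := epoch S l ∩ shift l ⁻¹' {z | ((m - l : ℕ) : ℕ∞) < T (ind z) 1})
          hz 1).symm
      · exact (Set.indicator_of_notMem
          (s := epoch S l ∩ shift l ⁻¹' {z | ((m - l : ℕ) : ℕ∞) < T (ind z) 1}) hz 1).symm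
  have hmeas : ∀ l, MeasurableSet
      (epoch S l ∩ shift l ⁻¹' {z | ((m - l : ℕ) : ℕ∞) < T (ind z) 1}) := fun l ↦
    (measurableSet_epoch l).inter (measurable_shift l (measurableSet_natCast_lt_T_one _))
  simp only [he]
  rw [lintegral_finsetSum _ fun l _ ↦ measurable_one.indicator (hmeas l)]
  refine Finset.sum_congr rfl fun l _ ↦ ?_
  rw [lintegral_indicator_one (hmeas l), h.measure_inter_shift (measurableSet_epoch_past l)
    subset_rfl (measurableSet_natCast_lt_T_one _)]
  rfl

/-- Whatever the past, the expected number of epochs in `[n, n + m)` is at most the one in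
`[0, m)`. -/
theorem sum_measure_inter_epoch_le (h : IsRegenerative ℒ) (m : ℕ) : ∀ (n : ℕ)
    (C : Set (ℕ → S × Bool)), MeasurableSet[past (S × Bool) n] C →
    ∑ k ∈ Finset.range m, ℒ (C ∩ epoch S (n + k)) ≤
      ℒ C * ∑ k ∈ Finset.range m, epochProb ℒ k := by
  induction m with
  | zero => simp
  | succ m ih =>
    -- Split `C` by whether `n` is an epoch. If it is, the path restarts there and equality holds.
    -- If not, the time `n` contributes nothing, and the induction hypothesis applies to the shorter
    -- window from `n + 1`.
    intro n C hC
    have hE := measurableSet_epoch_past (S := S) n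
    have hC1 := hC.inter hE
    have hC2 := hC.diff hE
    have hsplit : ∀ A : Set (ℕ → S × Bool), ℒ (C ∩ A) =
        ℒ (C ∩ epoch S n ∩ A) + ℒ (C \ epoch S n ∩ A) := fun A ↦ by
      rw [← measure_inter_add_sdiff (C ∩ A) (measurableSet_epoch n)]
      congr 2 <;> ext z <;> simp [and_comm, and_assoc, and_left_comm]
    have h1 : ∀ k, ℒ (C ∩ epoch S n ∩ epoch S (n + k)) = ℒ (C ∩ epoch S n) * epochProb ℒ k := by
      intro k
      rw [epochProb, ← h.measure_inter_shift hC1 Set.inter_subset_right (measurableSet_epoch k)]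
      congr 1
      ext z
      simp only [Set.mem_inter_iff, Set.mem_preimage]
      refine and_congr_right fun hz ↦ ?_
      rcases k with _ | k
      · exact iff_of_true hz.2 (Or.inl rfl)
      · simp [epoch, IsEpoch, ind, shift, ← add_assoc]
    have h2 : ∑ k ∈ Finset.range (m + 1), ℒ (C \ epoch S n ∩ epoch S (n + k)) ≤
        ℒ (C \ epoch S n) * ∑ k ∈ Finset.range (m + 1), epochProb ℒ k := by
      rw [Finset.sum_range_succ', add_zero, Set.sdiff_inter_self, measure_empty, add_zero]
      calc _ = ∑ k ∈ Finset.range m, ℒ (C \ epoch S n ∩ epoch S (n + 1 + k)) :=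
            Finset.sum_congr rfl fun k _ ↦ by rw [add_right_comm, add_assoc]
        _ ≤ _ := ih (n + 1) _ (past_mono n.le_succ _ hC2)
        _ ≤ _ := by
          gcongr
          exact m.le_succ
    calc ∑ k ∈ Finset.range (m + 1), ℒ (C ∩ epoch S (n + k))
        = ℒ (C ∩ epoch S n) * ∑ k ∈ Finset.range (m + 1), epochProb ℒ k +
          ∑ k ∈ Finset.range (m + 1), ℒ (C \ epoch S n ∩ epoch S (n + k)) := by
          rw [Finset.mul_sum, ← Finset.sum_add_distrib]
          exact Finset.sum_congr rfl fun k _ ↦ by rw [hsplit, h1]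
      _ ≤ _ := by
          rw [← measure_inter_add_sdiff C (measurableSet_epoch n), add_mul]
          gcongr

theorem sum_epochProb_add_le [IsProbabilityMeasure ℒ] (h : IsRegenerative ℒ) (n m : ℕ) :
    ∑ l ∈ Finset.range (n + m), epochProb ℒ l ≤
      ∑ l ∈ Finset.range n, epochProb ℒ l + ∑ l ∈ Finset.range m, epochProb ℒ l := by
  rw [Finset.sum_range_add]
  refine add_le_add_right ?_ _
  simpa [epochProb] using h.sum_measure_inter_epoch_le m n Set.univ MeasurableSet.univ

end IsRegenerative

theorem lintegral_T_one (ℒ : Measure (ℕ → S × Bool)) :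
    ∫⁻ z, (T (ind z) 1 : ℝ≥0∞) ∂ℒ = ∑' j, tailProb ℒ j := by
  simp only [toENNReal_eq_tsum (T _ 1)]
  have he : ∀ (j : ℕ) (z : ℕ → S × Bool), (if (j : ℕ∞) < T (ind z) 1 then (1 : ℝ≥0∞) else 0) =
      {z | (j : ℕ∞) < T (ind z) 1}.indicator 1 z := fun j z ↦ by
    rw [Set.indicator_apply]; rfl
  simp only [he]
  rw [lintegral_tsum fun j ↦
    (measurable_one.indicator (measurableSet_natCast_lt_T_one j)).aemeasurable]
  exact tsum_congr fun j ↦ lintegral_indicator_one (measurableSet_natCast_lt_T_one j)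

theorem lintegral_T_one_sq (ℒ : Measure (ℕ → S × Bool)) :
    ∫⁻ z, (T (ind z) 1 : ℝ≥0∞) ^ 2 ∂ℒ = ∑' j, tailProb ℒ j + 2 * ∑' j : ℕ, tailProb ℒ j * j := by
  simp only [toENNReal_sq_eq_tsum (T _ 1)]
  have he : ∀ (j : ℕ) (z : ℕ → S × Bool), (if (j : ℕ∞) < T (ind z) 1 then (1 : ℝ≥0∞) else 0) =
      {z | (j : ℕ∞) < T (ind z) 1}.indicator 1 z := fun j z ↦ by
    rw [Set.indicator_apply]; rfl
  simp only [he]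
  rw [lintegral_tsum fun j ↦
    ((measurable_one.indicator (measurableSet_natCast_lt_T_one j)).const_mul _).aemeasurable,
    ← ENNReal.tsum_mul_left, ← ENNReal.tsum_add]
  refine tsum_congr fun j ↦ ?_
  rw [lintegral_const_mul _ (measurable_one.indicator (measurableSet_natCast_lt_T_one j)),
    lintegral_indicator_one (measurableSet_natCast_lt_T_one j), tailProb]
  ring

/-- The bound on the expected length of the simulated trajectory, freed of denominators. -/
theorem IsRegenerative.lintegral_stopTime_le [IsProbabilityMeasure ℒ] (h : IsRegenerative ℒ) (n : ℕ) :
    (∫⁻ z, (T (ind z) 1 : ℝ≥0∞) ∂ℒ) * ∫⁻ z, (stopTime (ind z) n : ℝ≥0∞) ∂ℒ +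
        ∫⁻ z, (T (ind z) 1 : ℝ≥0∞) ∂ℒ ≤
      (∫⁻ z, (T (ind z) 1 : ℝ≥0∞) ∂ℒ) * n + ∫⁻ z, (T (ind z) 1 : ℝ≥0∞) ^ 2 ∂ℒ := by
  rw [h.lintegral_stopTime, lintegral_T_one_sq, lintegral_T_one, mul_comm (∑ m ∈ _, _),
    add_comm (∑' j, tailProb ℒ j) (2 * _), ← add_assoc]
  gcongr
  exact tsum_sq_mul_sum_range_le h.sum_epochProb_add_le h.sum_epochProb_mul_tailProb n

end Regenerative

/-- The random denominator is at least `n`; replacing it by `n` is the only loss in (i). -/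
theorem sq_estimator_sub_le {S : Type*} {x : ℕ → S} {γ : ℕ → Bool} {n : ℕ} (hn : 1 ≤ n)
    (hfin : stopTime γ n ≠ ⊤) (f : S → ℝ) (θ : ℝ) :
    (estimator x γ f n - θ) ^ 2 ≤ trajSum x γ (fun y ↦ f y - θ) n ^ 2 / (n : ℝ) ^ 2 := by
  have hle : n ≤ (stopTime γ n).toNat := by
    have := natCast_le_stopTime (γ := γ) n
    rwa [← ENat.natCast_toNat hfin, Nat.cast_le] at this
  have hn0 : (0 : ℝ) < n := by exact_mod_cast hn
  have hle' : (n : ℝ) ≤ (stopTime γ n).toNat := by exact_mod_cast hle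
  have hN0 := hn0.trans_le hle'
  have : estimator x γ f n - θ =
      trajSum x γ (fun y ↦ f y - θ) n / (stopTime γ n).toNat := by
    rw [estimator, trajSum, Finset.sum_sub_distrib, Finset.sum_const, Finset.card_range,
      nsmul_eq_mul]
    field_simp
  rw [this, div_pow]
  gcongr

/-! ### Second moment of the trajectory sum. -/

section Wald

variable {S : Type*} [MeasurableSpace S] {ℒ : Measure (ℕ → S × Bool)} [IsProbabilityMeasure ℒ]

theorem IsRegenerative.ae_stopTime_ne_top (h : IsRegenerative ℒ)
    (hT : ∫⁻ z, (T (ind z) 1 : ℝ≥0∞) ∂ℒ ≠ ∞) (n : ℕ) : ∀ᵐ z ∂ℒ, stopTime (ind z) n ≠ ⊤ := by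
  have hm : Measurable fun z : ℕ → S × Bool ↦ (stopTime (ind z) n : ℝ≥0∞) :=
    (measurable_of_countable _).comp ((measurable_stopTime n).comp measurable_ind)
  have hfin : ∫⁻ z, (stopTime (ind z) n : ℝ≥0∞) ∂ℒ ≠ ∞ := by
    rw [h.lintegral_stopTime]
    exact ENNReal.mul_ne_top (ENNReal.sum_ne_top.2 fun m _ ↦ measure_ne_top _ _) hT
  filter_upwards [ae_lt_top hm hfin] with z hz
  exact ENat.toENNReal_ne_top.1 hz.ne

/-- Wald's second identity. -/
theorem IsRegenerative.integral_trajSum_sq (h : IsRegenerative ℒ)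
    (hT : ∫⁻ z, (T (ind z) 1 : ℝ≥0∞) ∂ℒ ≠ ∞) {g : S → ℝ} (hg : Measurable g)
    (hL2 : MemLp (fun z ↦ blockSum (pos z) (ind z) g 1) 2 ℒ)
    (hmean : ∫ z, blockSum (pos z) (ind z) g 1 ∂ℒ = 0) (n : ℕ) :
    MemLp (fun z ↦ trajSum (pos z) (ind z) g n) 2 ℒ ∧
      ∫ z, trajSum (pos z) (ind z) g n ^ 2 ∂ℒ =
        (∑ m ∈ Finset.range n, (epochProb ℒ m).toReal) *
          ∫ z, blockSum (pos z) (ind z) g 1 ^ 2 ∂ℒ := by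
  induction n with
  | zero => simp [trajSum, stopTime_zero]
  | succ n ih =>
    -- Square integrability is carried through the induction to make the cross term integrable.
    obtain ⟨ihL, ihe⟩ := ih
    set Ξ : (ℕ → S × Bool) → ℝ := fun z ↦ blockSum (pos z) (ind z) g 1 with hΞ
    have hΞm : Measurable Ξ := measurable_blockSum_one hg
    set A := epoch S n with hA
    have hAm : MeasurableSet A := measurableSet_epoch n
    set Y : (ℕ → S × Bool) → ℝ := A.indicator fun z ↦ Ξ (shift n z) with hY
    have hYm : Measurable Y := (hΞm.comp (measurable_shift n)).indicator hAm
    have hmap : (ℒ.restrict A).map (shift n) = ℒ A • ℒ :=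
      h.map_shift n A (measurableSet_epoch_past n) subset_rfl
    have hYsq : (fun z ↦ Y z ^ 2) = A.indicator fun z ↦ Ξ (shift n z) ^ 2 := by
      funext z
      by_cases hz : z ∈ A <;> simp [hY, hz]
    have hYint : Integrable (fun z ↦ Y z ^ 2) ℒ := by
      rw [hYsq, integrable_indicator_iff hAm, IntegrableOn]
      have : Integrable (fun z ↦ Ξ z ^ 2) ((ℒ.restrict A).map (shift n)) := by
        rw [hmap]
        exact hL2.integrable_sq.smul_measure (measure_ne_top _ _)
      exact this.comp_measurable (measurable_shift n)
    have hYL : MemLp Y 2 ℒ := (memLp_two_iff_integrable_sq hYm.aestronglyMeasurable).2 hYint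
    have hYval : ∫ z, Y z ^ 2 ∂ℒ = (epochProb ℒ n).toReal * ∫ z, Ξ z ^ 2 ∂ℒ := by
      rw [hYsq, integral_indicator hAm,
        ← integral_map (φ := shift n) (f := fun z ↦ Ξ z ^ 2) (measurable_shift n).aemeasurable
          (hΞm.pow_const 2).aestronglyMeasurable, hmap, integral_smul_measure]
      rfl
    -- At an epoch `n` the trajectory sum runs over `i < n`, so it is a function of the past; the
    -- block begun at `n` is independent of it and has mean zero.
    have hcross : ∫ z, trajSum (pos z) (ind z) g n * Y z ∂ℒ = 0 := by
      have hG : Measurable fun w : Fin n → S × Bool ↦ ∑ i, g (w i).1 :=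
        Finset.measurable_sum _ fun i _ ↦ hg.comp (measurable_pi_apply i).fst
      calc ∫ z, trajSum (pos z) (ind z) g n * Y z ∂ℒ
          = ∫ z, A.indicator
              (fun z ↦ (∑ i, g (initSeg n z i).1) * Ξ (shift n z)) z ∂ℒ := by
            congr 1
            funext z
            by_cases hz : z ∈ A
            · rw [hY, Set.indicator_of_mem hz, Set.indicator_of_mem hz, trajSum_of_isEpoch hz,
                ← Fin.sum_univ_eq_sum_range (fun i ↦ g (pos z i))]
              rfl
            · rw [hY, Set.indicator_of_notMem hz, Set.indicator_of_notMem hz, mul_zero]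
        _ = _ := by
            rw [integral_indicator hAm, h.setIntegral_mul_shift n hG hΞm, hmean, mul_zero]
    have hae : (fun z ↦ trajSum (pos z) (ind z) g (n + 1)) =ᵐ[ℒ]
        fun z ↦ trajSum (pos z) (ind z) g n + Y z := by
      filter_upwards [h.ae_stopTime_ne_top hT (n + 1)] with z hz
      rw [trajSum_succ hz]
      congr 1
      by_cases hz : z ∈ A
      · rw [hY, Set.indicator_of_mem hz, if_pos (show IsEpoch n (ind z) from hz)]
        rfl
      · rw [hY, Set.indicator_of_notMem hz, if_neg (show ¬ IsEpoch n (ind z) from hz)]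
    refine ⟨(memLp_congr_ae hae).2 (ihL.add hYL), ?_⟩
    have hint : Integrable (fun z ↦ trajSum (pos z) (ind z) g n * Y z) ℒ :=
      ihL.integrable_mul hYL
    calc ∫ z, trajSum (pos z) (ind z) g (n + 1) ^ 2 ∂ℒ
        = ∫ z, (trajSum (pos z) (ind z) g n ^ 2 + 2 * (trajSum (pos z) (ind z) g n * Y z)
            + Y z ^ 2) ∂ℒ := by
          refine integral_congr_ae ?_
          filter_upwards [hae] with z hz
          rw [hz]
          ring
      _ = ∫ z, trajSum (pos z) (ind z) g n ^ 2 ∂ℒ + ∫ z, Y z ^ 2 ∂ℒ := by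
          have hsum : Integrable (fun z ↦ trajSum (pos z) (ind z) g n ^ 2 +
              2 * (trajSum (pos z) (ind z) g n * Y z)) ℒ :=
            ihL.integrable_sq.add (hint.const_mul 2)
          rw [integral_add hsum hYint,
            integral_add ihL.integrable_sq (hint.const_mul 2), integral_const_mul, hcross]
          ring
      _ = _ := by
          rw [ihe, hYval, Finset.sum_range_succ]
          ring

theorem IsRegenerative.lintegral_trajSum_sq (h : IsRegenerative ℒ)
    (hT : ∫⁻ z, (T (ind z) 1 : ℝ≥0∞) ∂ℒ ≠ ∞) {g : S → ℝ} (hg : Measurable g)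
    (hL2 : MemLp (fun z ↦ blockSum (pos z) (ind z) g 1) 2 ℒ)
    (hmean : ∫ z, blockSum (pos z) (ind z) g 1 ∂ℒ = 0) (n : ℕ) :
    ∫⁻ z, ENNReal.ofReal (trajSum (pos z) (ind z) g n ^ 2) ∂ℒ =
      (∑ m ∈ Finset.range n, epochProb ℒ m) *
        ∫⁻ z, ENNReal.ofReal (blockSum (pos z) (ind z) g 1 ^ 2) ∂ℒ := by
  obtain ⟨hL, he⟩ := h.integral_trajSum_sq hT hg hL2 hmean n
  rw [← ofReal_integral_eq_lintegral_ofReal hL.integrable_sq (ae_of_all _ fun z ↦ sq_nonneg _),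
    ← ofReal_integral_eq_lintegral_ofReal hL2.integrable_sq (ae_of_all _ fun z ↦ sq_nonneg _), he,
    ENNReal.ofReal_mul (Finset.sum_nonneg fun m _ ↦ ENNReal.toReal_nonneg),
    ENNReal.ofReal_sum_of_nonneg fun m _ ↦ ENNReal.toReal_nonneg]
  congr 1
  exact Finset.sum_congr rfl fun m _ ↦ ENNReal.ofReal_toReal (measure_ne_top _ _)

end Wald

/-! ### Regeneration of the split chain and Kac's formula. -/

section SplitChain

variable {S : Type*} [MeasurableSpace S] {π : Measure S} {P : Kernel S S} {J : Set S} {β : ℝ}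
  {ν : Measure S}

/-- Time `0` is an epoch with an empty past: an event of that past is empty or the whole space. -/
theorem map_shift_zero_restrict {E : Type*} [MeasurableSpace E] (ρ : Measure (ℕ → E))
    {C : Set (ℕ → E)} (hC : MeasurableSet[past E 0] C) [IsProbabilityMeasure ρ] :
    (ρ.restrict C).map (shift 0) = ρ C • ρ := by
  have hs : shift (E := E) 0 = id := by funext z i; simp [shift]
  obtain ⟨A, -, rfl⟩ := hC
  rw [hs, Measure.map_id]
  by_cases hA : Fin.elim0 ∈ A
  · have : initSeg (E := E) 0 ⁻¹' A = Set.univ :=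
      Set.eq_univ_of_forall fun z ↦ by
        rwa [Set.mem_preimage, Subsingleton.elim (initSeg 0 z) Fin.elim0]
    simp [this]
  · have : initSeg (E := E) 0 ⁻¹' A = ∅ :=
      Set.eq_empty_of_forall_notMem fun z ↦ by
        rwa [Set.mem_preimage, Subsingleton.elim (initSeg 0 z) Fin.elim0]
    simp [this]

theorem invariant_pow {α : Type*} [MeasurableSpace α] {κ : Kernel α α} {ρ : Measure α}
    (hκ : κ.Invariant ρ) (n : ℕ) : (κ ^ n).Invariant ρ := by
  induction n with
  | zero => exact Measure.bind_dirac
  | succ n ih => rw [pow_succ]; exact ih.comp hκ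

/-- An invariant measure of an irreducible kernel that gives no mass to a set of positive
measure vanishes. -/
theorem eq_zero_of_invariant (hirr : P.IsIrreducible π) (hJ : MeasurableSet J) (hπJ : 0 < π J)
    {η : Measure S} (hη : P.Invariant η) (hηJ : η J = 0) : η = 0 := by
  have hall : ∀ᵐ x ∂η, ∀ n : ℕ, (P ^ n) x J = 0 := by
    refine ae_all_iff.2 fun n ↦ ?_
    have hn : ∫⁻ x, (P ^ n) x J ∂η = 0 := by
      rw [← Measure.bind_apply hJ (Kernel.aemeasurable _), (invariant_pow hη n).def, hηJ]
    exact (lintegral_eq_zero_iff ((P ^ n).measurable_coe hJ)).1 hn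
  -- Irreducibility contradicts `hall` at every point, so a property that never holds holds
  -- `η`-almost everywhere.
  rw [← ae_eq_bot, ← Filter.eventually_false_iff_eq_bot]
  filter_upwards [hall] with x hx
  obtain ⟨n, hn⟩ := hirr.irreducible hJ hπJ x
  exact hn.ne' (hx n)

theorem lintegral_coinKernel (h : IsSmallSet π P J β ν) (x : S) (F : Bool → ℝ≥0∞) :
    ∫⁻ b, F b ∂coinKernel h x =
      regenProb J β x * F true + (1 - regenProb J β x) * F false := by
  simp [coinKernel]

variable [IsMarkovKernel P] [IsProbabilityMeasure ν] (h : IsSmallSet π P J β ν)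

theorem splitKernel_apply (z : S × Bool) :
    splitKernel h z = (stepKernel h z) ⊗ₘ coinKernel h := by
  rw [splitKernel, Kernel.compProd_apply_eq_compProd_sectR]
  rfl

theorem splitKernel_apply_true (x : S) : splitKernel h (x, true) = ν ⊗ₘ coinKernel h := by
  rw [splitKernel_apply, stepKernel, Kernel.piecewise_apply, if_pos (by simp), Kernel.const_apply]

theorem splitKernel_apply_false (x : S) :
    splitKernel h (x, false) = residualKernel h x ⊗ₘ coinKernel h := by
  rw [splitKernel_apply, stepKernel, Kernel.piecewise_apply, if_neg (by simp), Kernel.comap_apply]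

/-- The kernel `P` is the mixture of `ν` and of the residual kernel. -/
theorem regenProb_mul_add_residual (x : S) {A : Set S} (hA : MeasurableSet A) :
    regenProb J β x * ν A + (1 - regenProb J β x) * residualKernel h x A = P x A := by
  have hle := h.regenProb_le_one x
  by_cases hx : regenProb J β x < 1
  · have : IsFiniteMeasure (regenProb J β x • ν) :=
      ⟨(h.minorization x Set.univ).trans_lt (measure_lt_top _ _)⟩
    have hr : residualKernel h x A =
        (1 - regenProb J β x)⁻¹ * (P x A - regenProb J β x * ν A) := by
      simp only [residualKernel, Kernel.coe_mk]
      rw [if_pos hx, Measure.smul_apply, Measure.sub_apply hA (h.minorization x),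
        Measure.smul_apply, smul_eq_mul, smul_eq_mul]
    rw [hr, ← mul_assoc, ENNReal.mul_inv_cancel (tsub_pos_of_lt hx).ne' (by finiteness), one_mul]
    exact add_tsub_cancel_of_le (by simpa using h.minorization x A)
  -- The denominator vanishes here, and `ν ≤ P x` between probability measures is an equality.
  · have h1 : regenProb J β x = 1 := le_antisymm hle (not_lt.1 hx)
    have hν : ν ≤ P x := by simpa [h1] using h.minorization x
    have : ν = P x := Measure.eq_of_le_of_measure_univ_eq hν (by simp)
    simp [h1, ← this]

variable {ℒ : Measure (ℕ → S × Bool)}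

/-- The split chain started from its regeneration law is regenerative. -/
theorem isRegenerative_of_isPathLaw [IsProbabilityMeasure ℒ] (hℒ : IsPathLaw (splitKernel h) ℒ)
    (h0 : ℒ.map (fun z ↦ z 0) = ν ⊗ₘ coinKernel h) : IsRegenerative ℒ := by
  refine ⟨fun m C hC hCe ↦ ?_⟩
  rcases m with _ | m
  · exact map_shift_zero_restrict ℒ hC
  have hfin : IsFiniteMeasure (ℒ C • ℒ) := ⟨by simp⟩
  -- Both sides are path laws of the same kernel, so it suffices to compare them at time `0`.
  refine (hℒ.map_shift_restrict hC).unique (hℒ.smul (ℒ C)) ?_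
  refine Measure.ext fun B hB ↦ ?_
  have hev : Measurable fun z : ℕ → S × Bool ↦ z 0 := measurable_pi_apply 0
  have hB' : MeasurableSet ((fun z : ℕ → S × Bool ↦ z 0) ⁻¹' B) := hev hB
  rw [Measure.map_map hev (measurable_shift _), Measure.map_apply (hev.comp (measurable_shift _)) hB,
    Measure.restrict_apply ((hev.comp (measurable_shift _)) hB), Measure.map_smul,
    Measure.smul_apply, h0, smul_eq_mul, Set.inter_comm]
  calc ℒ (C ∩ {z | z (m + 1) ∈ B}) = ∫⁻ z in C, splitKernel h (z m) B ∂ℒ := hℒ m C hC B hB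
    -- On `C` the indicator at time `m` is `true`, and the transition then forgets the position.
    _ = ∫⁻ _ in C, (ν ⊗ₘ coinKernel h) B ∂ℒ := by
        refine setLIntegral_congr_fun (past_le _ _ hC) fun z hz ↦ ?_
        have hz' : (z m).2 = true := by simpa [epoch, IsEpoch, ind] using hCe hz
        have : z m = ((z m).1, true) := Prod.ext rfl hz'
        rw [this, splitKernel_apply_true]
    _ = _ := by rw [setLIntegral_const, mul_comm]

/-- The law of the position at time `n` on the event that the first cycle is longer than `n`. -/
noncomputable def occLaw : ℕ → Measure S
  | 0 => ν
  | n + 1 => ((occLaw n).withDensity fun x ↦ 1 - regenProb J β x).bind (residualKernel h)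

theorem lintegral_occLaw_succ (n : ℕ) {F : S → ℝ≥0∞} (hF : Measurable F) :
    ∫⁻ x, F x ∂occLaw h (n + 1) =
      ∫⁻ x, (1 - regenProb J β x) * ∫⁻ y, F y ∂residualKernel h x ∂occLaw h n := by
  have hd : Measurable fun x ↦ 1 - regenProb J β x := measurable_const.sub h.measurable_regenProb
  rw [occLaw, Measure.lintegral_bind (Kernel.aemeasurable _) hF.aemeasurable,
    lintegral_withDensity_eq_lintegral_mul _ hd hF.lintegral_kernel]
  rfl

theorem occLaw_succ_apply (n : ℕ) {A : Set S} (hA : MeasurableSet A) :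
    occLaw h (n + 1) A =
      ∫⁻ x, (1 - regenProb J β x) * residualKernel h x A ∂occLaw h n := by
  rw [← lintegral_indicator_one hA, lintegral_occLaw_succ h n (measurable_one.indicator hA)]
  simp only [lintegral_indicator_one hA]

instance sFinite_occLaw (n : ℕ) : SFinite (occLaw h n) := by
  induction n with
  | zero => rw [occLaw]; infer_instance
  | succ n ih => rw [occLaw]; infer_instance

/-- The event involves only indicators before `n`, so the one at `n` is still a fresh coin given the
position. The cycle goes on when it shows `false`, whence the factor `1 - regenProb J β x` and a
move by the residual kernel. -/
theorem map_eval_restrict_eq_occLaw (hℒ : IsPathLaw (splitKernel h) ℒ)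
    (h0 : ℒ.map (fun z ↦ z 0) = ν ⊗ₘ coinKernel h) (n : ℕ) :
    (ℒ.restrict {z | (n : ℕ∞) < T (ind z) 1}).map (fun z ↦ z n) = occLaw h n ⊗ₘ coinKernel h := by
  induction n with
  | zero =>
    have : {z : ℕ → S × Bool | ((0 : ℕ) : ℕ∞) < T (ind z) 1} = Set.univ :=
      Set.eq_univ_of_forall fun z ↦ natCast_lt_T_one_iff.2 (by simp)
    rw [this, Measure.restrict_univ, h0, occLaw]
  | succ n ih =>
    refine Measure.ext fun B hB ↦ ?_
    have hev : ∀ i, Measurable fun z : ℕ → S × Bool ↦ z i := fun i ↦ measurable_pi_apply i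
    have hfalse : MeasurableSet {q : S × Bool | q.2 = false} :=
      measurableSet_eq_fun measurable_snd measurable_const
    set D : Set (ℕ → S × Bool) := {z | ((n + 1 : ℕ) : ℕ∞) < T (ind z) 1} with hD
    have hDeq : D = (fun z : ℕ → S × Bool ↦ z n) ⁻¹' {q | q.2 = false} ∩ {z | (n : ℕ∞) < T (ind z) 1} := by
      ext z
      simp only [hD, Set.mem_ofPred_eq, natCast_lt_T_one_iff, Set.mem_inter_iff, Set.mem_preimage]
      exact Nat.forall_lt_succ_right.trans and_comm
    have hDpast : MeasurableSet[past (S × Bool) (n + 1)] D := by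
      have : D = ⋂ i : ℕ, ⋂ _ : i < n + 1,
          (fun z : ℕ → S × Bool ↦ z i) ⁻¹' {q : S × Bool | q.2 = false} := by
        ext z
        simp only [hD, Set.mem_ofPred_eq, natCast_lt_T_one_iff, Set.mem_iInter, Set.mem_preimage]
        rfl
      rw [this]
      exact MeasurableSet.iInter fun i ↦ MeasurableSet.iInter fun hi ↦
        measurable_eval_past hi hfalse
    have hF : Measurable fun q : S × Bool ↦
        {q : S × Bool | q.2 = false}.indicator (fun q ↦ splitKernel h q B) q :=
      (Kernel.measurable_coe _ hB).indicator hfalse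
    have hcB : Measurable fun y ↦ coinKernel h y (Prod.mk y ⁻¹' B) :=
      Kernel.measurable_kernel_prodMk_left hB
    rw [Measure.map_apply (hev _) hB, Measure.restrict_apply (hev _ hB), Set.inter_comm]
    calc ℒ (D ∩ {z | z (n + 1) ∈ B}) = ∫⁻ z in D, splitKernel h (z n) B ∂ℒ := hℒ n D hDpast B hB
      _ = ∫⁻ z in {z | (n : ℕ∞) < T (ind z) 1},
            {q : S × Bool | q.2 = false}.indicator (fun q ↦ splitKernel h q B) (z n) ∂ℒ := by
          rw [hDeq, ← Measure.restrict_restrict (hev n hfalse),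
            ← lintegral_indicator (hev n hfalse)]
          rfl
      _ = ∫⁻ q, {q : S × Bool | q.2 = false}.indicator (fun q ↦ splitKernel h q B) q
            ∂(occLaw h n ⊗ₘ coinKernel h) := by
          rw [← ih, lintegral_map hF (hev n)]
      _ = ∫⁻ x, (1 - regenProb J β x) * (residualKernel h x ⊗ₘ coinKernel h) B ∂occLaw h n := by
          rw [Measure.lintegral_compProd hF]
          refine lintegral_congr fun x ↦ ?_
          rw [lintegral_coinKernel]
          simp [splitKernel_apply_false]
      _ = _ := by
          rw [Measure.compProd_apply hB, lintegral_occLaw_succ h n hcB]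
          simp only [Measure.compProd_apply hB]

theorem occLaw_univ (hℒ : IsPathLaw (splitKernel h) ℒ)
    (h0 : ℒ.map (fun z ↦ z 0) = ν ⊗ₘ coinKernel h) (n : ℕ) :
    occLaw h n Set.univ = tailProb ℒ n := by
  have := congrArg (fun ρ ↦ ρ Set.univ) (map_eval_restrict_eq_occLaw h hℒ h0 n)
  simp only [Measure.compProd_apply_univ] at this
  rw [← this, Measure.map_apply (measurable_pi_apply n) MeasurableSet.univ, tailProb]
  simp

/-- The occupation measure of the first cycle. -/
noncomputable def cycleMeasure : Measure S := Measure.sum (occLaw h)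

theorem lintegral_cycleMeasure (F : S → ℝ≥0∞) :
    ∫⁻ x, F x ∂cycleMeasure h = ∑' n, ∫⁻ x, F x ∂occLaw h n :=
  lintegral_sum_measure _ _

theorem lintegral_regenProb_add_occLaw_succ (n : ℕ) :
    ∫⁻ x, regenProb J β x ∂occLaw h n + occLaw h (n + 1) Set.univ = occLaw h n Set.univ := by
  rw [occLaw_succ_apply h n MeasurableSet.univ, ← lintegral_add_left h.measurable_regenProb,
    ← lintegral_one]
  refine lintegral_congr fun x ↦ ?_
  rw [measure_univ, mul_one, add_tsub_cancel_of_le (h.regenProb_le_one x)]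

/-- A cycle contains one regeneration: each step loses exactly the mass that regenerates, and the
finite total mass lets the series telescope. -/
theorem lintegral_regenProb_cycleMeasure (hfin : cycleMeasure h Set.univ ≠ ∞) :
    ∫⁻ x, regenProb J β x ∂cycleMeasure h = 1 := by
  have hsum : cycleMeasure h Set.univ = ∑' n, occLaw h n Set.univ :=
    Measure.sum_apply _ MeasurableSet.univ
  have hsplit : ∑' n, occLaw h n Set.univ = 1 + ∑' n, occLaw h (n + 1) Set.univ := by
    rw [tsum_eq_zero_add' ENNReal.summable, occLaw, measure_univ]
  have hne : ∑' n, occLaw h (n + 1) Set.univ ≠ ∞ := fun ht ↦ hfin (by rw [hsum, hsplit, ht]; simp)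
  rw [← ENNReal.add_left_inj hne, ← hsplit, lintegral_cycleMeasure, ← ENNReal.tsum_add]
  exact tsum_congr (lintegral_regenProb_add_occLaw_succ h)

theorem lintegral_kernel_eq (ρ : Measure S) {A : Set S} (hA : MeasurableSet A) :
    ∫⁻ x, P x A ∂ρ = (∫⁻ x, regenProb J β x ∂ρ) * ν A +
      ∫⁻ x, (1 - regenProb J β x) * residualKernel h x A ∂ρ := by
  rw [← lintegral_mul_const _ h.measurable_regenProb,
    ← lintegral_add_left (h.measurable_regenProb.mul_const _)]
  exact lintegral_congr fun x ↦ (regenProb_mul_add_residual h x hA).symm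

/-- One step of `P` sends the regenerating mass, equal to one, to `ν = occLaw h 0`, and the
surviving part of `occLaw h n` to `occLaw h (n + 1)`. -/
theorem lintegral_kernel_cycleMeasure (hfin : cycleMeasure h Set.univ ≠ ∞) {A : Set S}
    (hA : MeasurableSet A) : ∫⁻ x, P x A ∂cycleMeasure h = cycleMeasure h A := by
  rw [lintegral_kernel_eq h _ hA, lintegral_regenProb_cycleMeasure h hfin, one_mul,
    lintegral_cycleMeasure, cycleMeasure, Measure.sum_apply _ hA,
    tsum_eq_zero_add' (f := fun n ↦ occLaw h n A) ENNReal.summable]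
  congr 1
  exact tsum_congr fun n ↦ (occLaw_succ_apply h n hA).symm

/-- Write `s` for `regenProb J β` and `c` for its `π`-integral. Invariance reads `π = c ν + ((1 - s)
π) Q`; inserting the lower bound for `N` on the right gives the one for `N + 1`. -/
theorem mul_sum_occLaw_le (hinv : P.Invariant π) (N : ℕ) :
    (∫⁻ x, regenProb J β x ∂π) • ∑ n ∈ Finset.range N, occLaw h n ≤ π := by
  induction N with
  | zero => simpa using Measure.zero_le π
  | succ N ih =>
    refine Measure.le_iff.2 fun A hA ↦ ?_
    set c := ∫⁻ x, regenProb J β x ∂π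
    have hπA : ∫⁻ x, P x A ∂π = π A := by
      conv_rhs => rw [← hinv.def, Measure.bind_apply hA (Kernel.aemeasurable _)]
    calc (c • ∑ n ∈ Finset.range (N + 1), occLaw h n) A
        = c * ν A + ∫⁻ x, (1 - regenProb J β x) * residualKernel h x A
            ∂(c • ∑ n ∈ Finset.range N, occLaw h n) := by
          rw [Finset.sum_range_succ', lintegral_smul_measure, lintegral_finsetSum_measure,
            Measure.smul_apply, Measure.add_apply, Measure.finsetSum_apply, smul_eq_mul,
            smul_eq_mul, mul_add, add_comm, occLaw]
          simp only [occLaw_succ_apply h _ hA]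
      _ ≤ c * ν A + ∫⁻ x, (1 - regenProb J β x) * residualKernel h x A ∂π := by
          gcongr
      _ = π A := by rw [← lintegral_kernel_eq h π hA, hπA]

theorem smul_cycleMeasure_le (hinv : P.Invariant π) :
    (∫⁻ x, regenProb J β x ∂π) • cycleMeasure h ≤ π := by
  refine Measure.le_iff.2 fun A hA ↦ ?_
  rw [Measure.smul_apply, cycleMeasure, Measure.sum_apply _ hA, smul_eq_mul,
    ← ENNReal.tsum_mul_left]
  refine ENNReal.tsum_le_of_sum_range_le fun N ↦ ?_
  rw [← Finset.mul_sum, ← Measure.finsetSum_apply, ← smul_eq_mul, ← Measure.smul_apply]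
  exact mul_sum_occLaw_le h hinv N A

/-- Kac's formula: the invariant law is the normalized occupation measure of a cycle. -/
theorem eq_smul_cycleMeasure [IsProbabilityMeasure π] (hinv : P.Invariant π)
    (hirr : P.IsIrreducible π) (hfin : cycleMeasure h Set.univ ≠ ∞) :
    π = (∫⁻ x, regenProb J β x ∂π) • cycleMeasure h := by
  set c := ∫⁻ x, regenProb J β x ∂π with hc
  have hc1 : c ≤ 1 := by
    calc c ≤ ∫⁻ _, 1 ∂π := lintegral_mono h.regenProb_le_one
      _ = 1 := by simp
  have hctop : c ≠ ∞ := ne_top_of_le_ne_top ENNReal.one_ne_top hc1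
  have hle : c • cycleMeasure h ≤ π := smul_cycleMeasure_le h hinv
  have : IsFiniteMeasure (c • cycleMeasure h) :=
    ⟨(hle Set.univ).trans_lt (measure_lt_top _ _)⟩
  -- The remainder `η` is invariant as a difference of invariant measures. Both measures give
  -- `regenProb J β` the integral `c`, so `η` does not charge `J`.
  set η := π - c • cycleMeasure h
  have hdec : η + c • cycleMeasure h = π := Measure.sub_add_cancel_of_le hle
  have hηinv : P.Invariant η := by
    refine Measure.ext fun A hA ↦ ?_
    have h1 : ∫⁻ x, P x A ∂π = π A := by
      conv_rhs => rw [← hinv.def, Measure.bind_apply hA (Kernel.aemeasurable _)]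
    rw [← hdec, lintegral_add_measure, lintegral_smul_measure,
      lintegral_kernel_cycleMeasure h hfin hA, Measure.add_apply, Measure.smul_apply] at h1
    have hne : c • cycleMeasure h A ≠ ∞ :=
      ENNReal.mul_ne_top hctop (measure_ne_top_of_subset (Set.subset_univ A) hfin)
    rw [Measure.bind_apply hA (Kernel.aemeasurable _)]
    exact (ENNReal.add_left_inj hne).1 h1
  have hηs : ∫⁻ x, regenProb J β x ∂η = 0 := by
    have h1 : ∫⁻ x, regenProb J β x ∂(η + c • cycleMeasure h) = c := by rw [hdec]
    rw [lintegral_add_measure, lintegral_smul_measure, lintegral_regenProb_cycleMeasure h hfin,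
      smul_eq_mul, mul_one] at h1
    exact (ENNReal.add_left_inj hctop).1 (by rw [h1, zero_add])
  have hηJ : η J = 0 := by
    rw [regenProb, lintegral_indicator_const h.measurableSet] at hηs
    exact (mul_eq_zero.1 hηs).resolve_left (ENNReal.ofReal_pos.2 h.pos).ne'
  have hη0 := eq_zero_of_invariant hirr h.measurableSet h.measure_pos hηinv hηJ
  rw [hη0, zero_add] at hdec
  exact hdec.symm

end SplitChain

/-! ### Expected block sums. -/

section CycleMean

variable {S : Type*} [MeasurableSpace S] {π : Measure S} {P : Kernel S S} [IsMarkovKernel P]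
  {J : Set S} {β : ℝ} {ν : Measure S} [IsProbabilityMeasure ν] (h : IsSmallSet π P J β ν)
  {ℒ : Measure (ℕ → S × Bool)}

theorem cycleMeasure_univ (hℒ : IsPathLaw (splitKernel h) ℒ)
    (h0 : ℒ.map (fun z ↦ z 0) = ν ⊗ₘ coinKernel h) :
    cycleMeasure h Set.univ = ∫⁻ z, (T (ind z) 1 : ℝ≥0∞) ∂ℒ := by
  rw [lintegral_T_one, cycleMeasure, Measure.sum_apply _ MeasurableSet.univ]
  exact tsum_congr (occLaw_univ h hℒ h0)

/-- Indicators of `i < T₁` turn the random sum into a series, and Tonelli leaves the law of the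
position on each such event. -/
theorem lintegral_sum_cycle (hℒ : IsPathLaw (splitKernel h) ℒ)
    (h0 : ℒ.map (fun z ↦ z 0) = ν ⊗ₘ coinKernel h)
    (hfin : ∫⁻ z, (T (ind z) 1 : ℝ≥0∞) ∂ℒ ≠ ∞) {F : S → ℝ≥0∞} (hF : Measurable F) :
    ∫⁻ z, ∑ i ∈ Finset.range (T (ind z) 1).toNat, F (pos z i) ∂ℒ = ∫⁻ x, F x ∂cycleMeasure h := by
  have hpos : ∀ i, Measurable fun z : ℕ → S × Bool ↦ F (pos z i) := fun i ↦
    hF.comp (measurable_pi_apply i).fst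
  calc ∫⁻ z, ∑ i ∈ Finset.range (T (ind z) 1).toNat, F (pos z i) ∂ℒ
      = ∫⁻ z, ∑' i : ℕ, {z | (i : ℕ∞) < T (ind z) 1}.indicator (fun z ↦ F (pos z i)) z ∂ℒ := by
        refine lintegral_congr_ae ?_
        filter_upwards [ae_lt_top measurable_toENNReal_T_one hfin] with z hz
        have hz' : T (ind z) 1 ≠ ⊤ := ENat.toENNReal_ne_top.1 hz.ne
        have hmem : ∀ i : ℕ, i ∈ Finset.range (T (ind z) 1).toNat ↔ (i : ℕ∞) < T (ind z) 1 := by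
          intro i
          rw [Finset.mem_range, ← Nat.cast_lt (α := ℕ∞), ENat.natCast_toNat hz']
        rw [tsum_eq_sum (s := Finset.range (T (ind z) 1).toNat)
          fun i hi ↦ Set.indicator_of_notMem
            (s := {z | (i : ℕ∞) < T (ind z) 1}) (fun hc ↦ hi ((hmem i).2 hc)) fun z ↦ F (pos z i)]
        exact Finset.sum_congr rfl fun i hi ↦
          (Set.indicator_of_mem (s := {z | (i : ℕ∞) < T (ind z) 1}) ((hmem i).1 hi)
            fun z ↦ F (pos z i)).symm
    _ = ∑' i : ℕ, ∫⁻ z in {z | (i : ℕ∞) < T (ind z) 1}, F (pos z i) ∂ℒ := by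
        rw [lintegral_tsum fun i ↦
          ((hpos i).indicator (measurableSet_natCast_lt_T_one i)).aemeasurable]
        exact tsum_congr fun i ↦ lintegral_indicator (measurableSet_natCast_lt_T_one i) _
    _ = ∑' i : ℕ, ∫⁻ x, F x ∂occLaw h i := by
        refine tsum_congr fun i ↦ ?_
        have hF' : Measurable fun q : S × Bool ↦ F q.1 := hF.comp measurable_fst
        have := lintegral_map (μ := ℒ.restrict {z | (i : ℕ∞) < T (ind z) 1}) hF'
          (measurable_pi_apply i)
        rw [map_eval_restrict_eq_occLaw h hℒ h0 i, Measure.lintegral_compProd hF'] at this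
        simp only [lintegral_const, measure_univ, mul_one] at this
        exact this.symm
    _ = _ := (lintegral_cycleMeasure h F).symm

/-- A function with stationary mean zero has block sums of mean zero. -/
theorem integral_blockSum_eq_zero [IsProbabilityMeasure π] (hinv : P.Invariant π)
    (hirr : P.IsIrreducible π) (hℒ : IsPathLaw (splitKernel h) ℒ)
    (h0 : ℒ.map (fun z ↦ z 0) = ν ⊗ₘ coinKernel h)
    (hfin : ∫⁻ z, (T (ind z) 1 : ℝ≥0∞) ∂ℒ ≠ ∞) {g : S → ℝ} (hg : Measurable g)
    (hgint : Integrable g π) (hmean : ∫ x, g x ∂π = 0) :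
    ∫ z, blockSum (pos z) (ind z) g 1 ∂ℒ = 0 := by
  set c := ∫⁻ x, regenProb J β x ∂π
  have hπ : π = c • cycleMeasure h :=
    eq_smul_cycleMeasure h hinv hirr (by rwa [cycleMeasure_univ h hℒ h0])
  have hc0 : c ≠ 0 := fun hc ↦ NeZero.ne π (by rw [hπ, hc, zero_smul])
  have hctop : c ≠ ∞ := by
    refine ne_top_of_le_ne_top ENNReal.one_ne_top ?_
    calc c ≤ ∫⁻ _, 1 ∂π := lintegral_mono h.regenProb_le_one
      _ = 1 := by simp
  have hscale : ∀ F : S → ℝ≥0∞, ∫⁻ x, F x ∂π = c * ∫⁻ x, F x ∂cycleMeasure h := fun F ↦ by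
    conv_lhs => rw [hπ, lintegral_smul_measure, smul_eq_mul]
  -- The cycle formula is for nonnegative functions, so `g` is split into its two parts; as `c ≠ 0`,
  -- their finite integrals pass from `π` to the cycle measure.
  have hp : ∫⁻ x, ENNReal.ofReal (g x) ∂π ≠ ∞ :=
    ((lintegral_mono fun x ↦ Real.ofReal_le_enorm (g x)).trans_lt hgint.2).ne
  have hn : ∫⁻ x, ENNReal.ofReal (-g x) ∂π ≠ ∞ :=
    ((lintegral_mono fun x ↦ Real.ofReal_le_enorm (-g x)).trans_lt hgint.neg.2).ne
  have heqπ : ∫⁻ x, ENNReal.ofReal (g x) ∂π = ∫⁻ x, ENNReal.ofReal (-g x) ∂π := by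
    rw [integral_eq_lintegral_pos_part_sub_lintegral_neg_part hgint, sub_eq_zero] at hmean
    exact (ENNReal.toReal_eq_toReal_iff' hp hn).1 hmean
  have hcyc : ∫⁻ x, ENNReal.ofReal (g x) ∂cycleMeasure h =
      ∫⁻ x, ENNReal.ofReal (-g x) ∂cycleMeasure h := by
    rw [hscale, hscale] at heqπ
    exact (ENNReal.mul_right_inj hc0 hctop).1 heqπ
  have hpart : ∀ {k : S → ℝ}, Measurable k → ∫⁻ x, ENNReal.ofReal (k x) ∂π ≠ ∞ →
      Integrable (fun z ↦ ∑ i ∈ Finset.range (T (ind z) 1).toNat,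
        (ENNReal.ofReal (k (pos z i))).toReal) ℒ ∧
      ∫ z, ∑ i ∈ Finset.range (T (ind z) 1).toNat, (ENNReal.ofReal (k (pos z i))).toReal ∂ℒ =
        (∫⁻ x, ENNReal.ofReal (k x) ∂cycleMeasure h).toReal := by
    intro k hk hkfin
    have hsum : ∀ z : ℕ → S × Bool, ∑ i ∈ Finset.range (T (ind z) 1).toNat,
        (ENNReal.ofReal (k (pos z i))).toReal =
        (∑ i ∈ Finset.range (T (ind z) 1).toNat, ENNReal.ofReal (k (pos z i))).toReal :=
      fun z ↦ (ENNReal.toReal_sum fun i _ ↦ ENNReal.ofReal_ne_top).symm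
    have hm : Measurable fun z : ℕ → S × Bool ↦
        ∑ i ∈ Finset.range (T (ind z) 1).toNat, ENNReal.ofReal (k (pos z i)) := by
      have he : ∀ z : ℕ → S × Bool,
          ∑ i ∈ Finset.range (T (ind z) 1).toNat, ENNReal.ofReal (k (pos z i)) =
          ENNReal.ofReal (∑ i ∈ Finset.range (T (ind z) 1).toNat, max (k (pos z i)) 0) := by
        intro z
        rw [ENNReal.ofReal_sum_of_nonneg fun i _ ↦ le_max_right _ _]
        simp [ENNReal.ofReal_max]
      simp only [he]
      exact (measurable_sum_range (g := fun x ↦ max (k x) 0) (hk.max measurable_const)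
        ((measurable_of_countable ENat.toNat).comp
          (measurable_T_one.comp measurable_ind))).ennreal_ofReal
    have hval := lintegral_sum_cycle h hℒ h0 hfin hk.ennreal_ofReal
    have hne : ∫⁻ x, ENNReal.ofReal (k x) ∂cycleMeasure h ≠ ∞ := fun ht ↦
      hkfin (by rw [hscale, ht, ENNReal.mul_top hc0])
    simp only [hsum]
    refine ⟨integrable_toReal_of_lintegral_ne_top hm.aemeasurable (by rwa [hval]), ?_⟩
    rw [integral_toReal hm.aemeasurable (ae_of_all _ fun z ↦
      ENNReal.sum_lt_top.2 fun i _ ↦ ENNReal.ofReal_lt_top), hval]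
  obtain ⟨hpi, hpv⟩ := hpart hg hp
  obtain ⟨hni, hnv⟩ := hpart (k := fun x ↦ -g x) hg.neg hn
  calc ∫ z, blockSum (pos z) (ind z) g 1 ∂ℒ
      = ∫ z, (∑ i ∈ Finset.range (T (ind z) 1).toNat, (ENNReal.ofReal (g (pos z i))).toReal -
          ∑ i ∈ Finset.range (T (ind z) 1).toNat, (ENNReal.ofReal (-g (pos z i))).toReal) ∂ℒ := by
        congr 1
        funext z
        rw [blockSum_one, ← Finset.sum_sub_distrib]
        refine Finset.sum_congr rfl fun i _ ↦ ?_
        rw [ENNReal.toReal_ofReal', ENNReal.toReal_ofReal']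
        exact (max_zero_sub_max_neg_zero_eq_self _).symm
    _ = 0 := by
        rw [integral_sub hpi hni, hpv, sub_eq_zero, hcyc]
        exact hnv.symm

end CycleMean

/-! ### Transfer from the probability space to path space. -/

section PathSpace

variable {S Ω : Type*} [MeasurableSpace S] [MeasurableSpace Ω] {X : ℕ → Ω → S} {Γ : ℕ → Ω → Bool}
  {μ : Measure Ω} {ℒ : Measure (ℕ → S × Bool)}

theorem meanTau_eq (hZ : Measurable fun ω n ↦ (X n ω, Γ n ω))
    (hℒ : ℒ = μ.map fun ω n ↦ (X n ω, Γ n ω)) :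
    meanTau Γ μ = ∫⁻ z, (T (ind z) 1 : ℝ≥0∞) ∂ℒ := by
  rw [hℒ, lintegral_map measurable_toENNReal_T_one hZ]
  simp only [meanTau, tau_one]
  rfl

theorem meanSqTau_eq (hZ : Measurable fun ω n ↦ (X n ω, Γ n ω))
    (hℒ : ℒ = μ.map fun ω n ↦ (X n ω, Γ n ω)) :
    meanSqTau Γ μ = ∫⁻ z, (T (ind z) 1 : ℝ≥0∞) ^ 2 ∂ℒ := by
  rw [hℒ, lintegral_map (measurable_toENNReal_T_one.pow_const 2) hZ]
  simp only [meanSqTau, tau_one]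
  rfl

theorem meanSqBlock_eq (hZ : Measurable fun ω n ↦ (X n ω, Γ n ω))
    (hℒ : ℒ = μ.map fun ω n ↦ (X n ω, Γ n ω)) {g : S → ℝ} (hg : Measurable g) :
    meanSqBlock X Γ g μ = ∫⁻ z, ENNReal.ofReal (blockSum (pos z) (ind z) g 1 ^ 2) ∂ℒ := by
  rw [hℒ, lintegral_map ((measurable_blockSum_one hg).pow_const 2).ennreal_ofReal hZ]
  rfl

theorem meanStopTime_eq (hZ : Measurable fun ω n ↦ (X n ω, Γ n ω))
    (hℒ : ℒ = μ.map fun ω n ↦ (X n ω, Γ n ω)) (n : ℕ) :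
    meanStopTime Γ n μ = ∫⁻ z, (stopTime (ind z) n : ℝ≥0∞) ∂ℒ := by
  have hm : Measurable fun z : ℕ → S × Bool ↦ (stopTime (ind z) n : ℝ≥0∞) :=
    (measurable_of_countable _).comp ((measurable_stopTime n).comp measurable_ind)
  rw [hℒ, lintegral_map hm hZ]
  rfl

theorem mse_le (hZ : Measurable fun ω n ↦ (X n ω, Γ n ω))
    (hℒ : ℒ = μ.map fun ω n ↦ (X n ω, Γ n ω)) {f : S → ℝ} (hf : Measurable f) (θ : ℝ)
    {n : ℕ} (hn : 1 ≤ n) (hfin : ∀ᵐ z ∂ℒ, stopTime (ind z) n ≠ ⊤) :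
    mse X Γ f θ n μ ≤
      (∫⁻ z, ENNReal.ofReal (trajSum (pos z) (ind z) (fun y ↦ f y - θ) n ^ 2) ∂ℒ) /
        (n : ℝ≥0∞) ^ 2 := by
  have hm : Measurable fun z ↦ ENNReal.ofReal (trajSum (pos z) (ind z) (fun y ↦ f y - θ) n ^ 2) :=
    ((measurable_trajSum (hf.sub_const θ) n).pow_const 2).ennreal_ofReal
  have hm' : Measurable fun ω ↦ ENNReal.ofReal (trajSum (pos fun n ↦ (X n ω, Γ n ω))
      (ind fun n ↦ (X n ω, Γ n ω)) (fun y ↦ f y - θ) n ^ 2) := hm.comp hZ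
  rw [hℒ] at hfin ⊢
  rw [lintegral_map hm hZ, div_eq_mul_inv, ← lintegral_mul_const _ hm']
  refine lintegral_mono_ae ?_
  filter_upwards [ae_of_ae_map hZ.aemeasurable hfin] with ω hω
  refine (ENNReal.ofReal_le_ofReal (sq_estimator_sub_le hn hω f θ)).trans_eq ?_
  have hn0 : (0 : ℝ) < n := by exact_mod_cast hn
  rw [ENNReal.ofReal_div_of_pos (by positivity), div_eq_mul_inv, ENNReal.ofReal_pow hn0.le,
    ENNReal.ofReal_natCast]
  rfl

end PathSpace

end Regen

theorem theorem1
    {S : Type*} [TopologicalSpace S] [PolishSpace S] [MeasurableSpace S] [BorelSpace S]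
    (π : Measure S) [IsProbabilityMeasure π]
    (P : Kernel S S) [IsMarkovKernel P]
    (hinv : P.Invariant π) (hirr : P.IsIrreducible π)
    (J : Set S) (β : ℝ) (ν : Measure S) [IsProbabilityMeasure ν]
    (hsmall : Regen.IsSmallSet π P J β ν)
    {Ω : Type*} [MeasurableSpace Ω] (μ : Measure Ω) [IsProbabilityMeasure μ]
    (X : ℕ → Ω → S) (Γ : ℕ → Ω → Bool) (hchain : Regen.IsSplitChain hsmall X Γ μ)
    (f : S → ℝ) (hf : Measurable f) (hfint : Integrable f π)
    (θ : ℝ) (hθ : θ = ∫ x, f x ∂π)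
    (hblock : Regen.meanSqBlock X Γ (fun x ↦ f x - θ) μ < ∞)
    (htau : Regen.meanSqTau Γ μ < ∞)
    (n : ℕ) (hn : 1 ≤ n) :
    Regen.mse X Γ f θ n μ
        ≤ Regen.asVar X Γ f θ μ / (n : ℝ≥0∞) ^ 2 * Regen.meanStopTime Γ n μ ∧
      Regen.meanStopTime Γ n μ ≤ (n : ℝ≥0∞) + Regen.nZero Γ μ := by
  have hchain' : Regen.IsMarkovChain (fun n ω ↦ (X n ω, Γ n ω)) (ν ⊗ₘ Regen.coinKernel hsmall)
    (Regen.splitKernel hsmall) μ := hchain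
  have hZ : Measurable fun ω n ↦ (X n ω, Γ n ω) := measurable_pi_lambda _ hchain'.measurable
  obtain ⟨ℒ, hℒ⟩ : ∃ ℒ, ℒ = μ.map fun ω n ↦ (X n ω, Γ n ω) := ⟨_, rfl⟩
  have hprob : IsProbabilityMeasure ℒ := hℒ ▸ Measure.isProbabilityMeasure_map hZ.aemeasurable
  have hpath : Regen.IsPathLaw (Regen.splitKernel hsmall) ℒ := hℒ ▸ hchain'.isPathLaw
  have h0 : ℒ.map (fun z ↦ z 0) = ν ⊗ₘ Regen.coinKernel hsmall := by
    rw [hℒ, Measure.map_map (measurable_pi_apply 0) hZ]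
    exact hchain'.initial.map_eq
  have hreg := Regen.isRegenerative_of_isPathLaw hsmall hpath h0
  set g : S → ℝ := fun x ↦ f x - θ
  have hg : Measurable g := hf.sub_const θ
  have hgint : Integrable g π := hfint.sub (integrable_const θ)
  have hgmean : ∫ x, g x ∂π = 0 := by
    rw [integral_sub hfint (integrable_const θ), ← hθ]
    simp
  rw [Regen.meanSqBlock_eq hZ hℒ hg] at hblock
  rw [Regen.meanSqTau_eq hZ hℒ] at htau
  rw [Regen.asVar, Regen.nZero, Regen.meanSqBlock_eq hZ hℒ hg, Regen.meanSqTau_eq hZ hℒ,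
    Regen.meanTau_eq hZ hℒ, Regen.meanStopTime_eq hZ hℒ]
  set M := ∫⁻ z, (Regen.T (Regen.ind z) 1 : ℝ≥0∞) ∂ℒ with hM
  set M2 := ∫⁻ z, (Regen.T (Regen.ind z) 1 : ℝ≥0∞) ^ 2 ∂ℒ with hM2
  have hT1 : ∀ z : ℕ → S × Bool, (1 : ℝ≥0∞) ≤ (Regen.T (Regen.ind z) 1 : ℝ≥0∞) := fun z ↦ by
    have := Regen.natCast_le_T (γ := Regen.ind z) 1
    exact_mod_cast ENat.toENNReal_le.2 this
  have hM1 : 1 ≤ M := by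
    calc (1 : ℝ≥0∞) = ∫⁻ _, 1 ∂ℒ := by simp
      _ ≤ M := lintegral_mono hT1
  have hM0 : M ≠ 0 := (zero_lt_one.trans_le hM1).ne'
  -- Since `τ₁ ≥ 1`, a finite second moment gives a finite mean.
  have hMle : M ≤ M2 := lintegral_mono fun z ↦ le_self_pow₀ (hT1 z) two_ne_zero
  have hMtop : M ≠ ∞ := (hMle.trans_lt htau).ne
  constructor
  · have hL2 : MemLp (fun z ↦ Regen.blockSum (Regen.pos z) (Regen.ind z) g 1) 2 ℒ := by
      have hm := Regen.measurable_blockSum_one hg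
      refine (memLp_two_iff_integrable_sq hm.aestronglyMeasurable).2
        ⟨(hm.pow_const 2).aestronglyMeasurable, ?_⟩
      rwa [hasFiniteIntegral_iff_ofReal (ae_of_all _ fun z ↦ sq_nonneg _)]
    have hmean := Regen.integral_blockSum_eq_zero hsmall hinv hirr hpath h0 hMtop hg hgint hgmean
    refine (Regen.mse_le hZ hℒ hf θ hn (hreg.ae_stopTime_ne_top hMtop n)).trans_eq ?_
    rw [hreg.lintegral_trajSum_sq hMtop hg hL2 hmean n, hreg.lintegral_stopTime, ← hM]
    set V := ∑ m ∈ Finset.range n, Regen.epochProb ℒ m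
    set B := ∫⁻ z, ENNReal.ofReal (Regen.blockSum (Regen.pos z) (Regen.ind z) g 1 ^ 2) ∂ℒ
    -- The expected number `V` of epochs before `n` is a factor of both the second moment and the
    -- mean length.
    calc V * B / (n : ℝ≥0∞) ^ 2 = V * B / (n : ℝ≥0∞) ^ 2 * (M⁻¹ * M) := by
          rw [ENNReal.inv_mul_cancel hM0 hMtop, mul_one]
      _ = B / M / (n : ℝ≥0∞) ^ 2 * (V * M) := by
          simp only [div_eq_mul_inv]
          ring
  · have hle := hreg.lintegral_stopTime_le n
    rw [← hM, ← hM2] at hle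
    set W := ∫⁻ z, (Regen.stopTime (Regen.ind z) n : ℝ≥0∞) ∂ℒ
    have h1 : 1 ≤ M2 / M := by
      rwa [ENNReal.le_div_iff_mul_le (Or.inl hM0) (Or.inl hMtop), one_mul]
    -- The bound is proved with `1` added to both sides, which keeps clear of subtraction in `ℝ≥0∞`.
    have h2 : W + 1 ≤ n + M2 / M := by
      refine (ENNReal.mul_le_mul_iff_right hM0 hMtop).1 ?_
      rw [mul_add, mul_one, mul_add, ENNReal.mul_div_cancel hM0 hMtop]
      exact hle
    refine (ENNReal.add_le_add_iff_right ENNReal.one_ne_top).1 (h2.trans_eq ?_)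
    rw [add_assoc, tsub_add_cancel_of_le h1]
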